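/- Let $\Omega\subset\mathbb{R}^3$ be a bounded, open, connected set with smooth boundary $\partial\Omega=\overline{\Gamma_0\cup\Gamma}$, where $\Gamma_0$ and $\Gamma$ are disjoint, connected, relatively open subsets of $\partial\Omega$ of positive surface measure. Assume that $\Gamma$ is flat (contained in a plane) and that the curve $\partial\Gamma=\partial\Gamma_0$ (boundaries relative to $\partial\Omega$) is smooth. Let $H^1_{\Gamma_0}(\Omega)=\{u\in H^1(\Omega): u|_{\Gamma_0}=0\}$, the restriction being understood in the sense of traces, let $H^2_0(\Gamma)$ be the closure of $C_c^\infty(\Gamma)$ in $H^2(\Gamma)$ (where $\Gamma$ is regarded as an open subset of its plane), and let $X=H^1_{\Gamma_0}(\Omega)\times H^2_0(\Gamma)$; all functions are real-valued. Let $1<p<5$. For $(u,w)\in X$ put $$J(u,w)=\tfrac12\left(\|\nabla u\|_{L^2(\Omega)}^2+\|\Delta w\|_{L^2(\Gamma)}^2\right)-\tfrac1{p+1}\left(\int_\Omega|u|^{p+1}\log|u|\,dx+\int_\Gamma|w|^{p+1}\log|w|\,d\Gamma\right)+\tfrac1{(p+1)^2}\left(\|u\|_{L^{p+1}(\Omega)}^{p+1}+\|w\|_{L^{p+1}(\Gamma)}^{p+1}\right),$$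 $$I(u,w)=\|\nabla u\|_{L^2(\Omega)}^2+\|\Delta w\|_{L^2(\Gamma)}^2-\int_\Omega|u|^{p+1}\log|u|\,dx-\int_\Gamma|w|^{p+1}\log|w|\,d\Gamma,$$ where $|s|^{p+1}\log|s|$ is taken to be $0$ at $s=0$, and let $\mathcal N=\{(u,w)\in X\setminus\{(0,0)\}: I(u,w)=0\}$ be the Nehari manifold. Then the depth of the potential well $$d:=\inf_{(u,w)\in\mathcal N}J(u,w)$$ is a strictly positive real number. -/

import Mathlib

noncomputable section

namespace StructuralAcoustic

open MeasureTheory Filter Topology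
open scoped ContDiff ENNReal

/-- Euclidean `n`-space with its Euclidean norm. -/
abbrev E (n : ℕ) : Type := EuclideanSpace ℝ (Fin n)

/-- `Ω` has a smooth boundary: near each boundary point, in suitable orthonormal coordinates, `Ω`
is the region strictly above the graph of a smooth function of the first `n` coordinates. -/
def HasSmoothBoundary {n : ℕ} (Ω : Set (E (n + 1))) : Prop :=
  ∀ x ∈ frontier Ω, ∃ (c : E (n + 1) ≃ᵃⁱ[ℝ] E (n + 1)) (g : E n → ℝ) (r : ℝ),
    ContDiff ℝ ∞ g ∧ 0 < r ∧
      ∀ y ∈ Metric.ball x r,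
        (y ∈ Ω ↔ g (WithLp.toLp 2 fun i : Fin n => c y i.castSucc) < c y (Fin.last n))

/-- The geometry: a bounded smooth domain `Ω ⊂ ℝ³` whose boundary is split into the rigid wall `Γ₀`
and the flat elastic wall `Γ`. The map `e` is an isometric parametrization of the plane that
contains `Γ`, so `e ⁻¹' Γ ⊂ ℝ²` is `Γ` in orthonormal coordinates of that plane. The boundary of
`Γ` (or `Γ₀`) relative to `∂Ω` is `closure Γ \ Γ`, since `Γ` is relatively open in the
closed set `∂Ω`. -/
structure IsChamber (Ω Γ₀ Γ : Set (E 3)) (e : E 2 →ᵃⁱ[ℝ] E 3) : Prop where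
  isOpen : IsOpen Ω
  isConnected : IsConnected Ω
  isBounded : Bornology.IsBounded Ω
  smooth : HasSmoothBoundary Ω
  boundary_eq : frontier Ω = closure (Γ₀ ∪ Γ)
  disjoint : Disjoint Γ₀ Γ
  relOpen_rigid : ∃ U : Set (E 3), IsOpen U ∧ Γ₀ = U ∩ frontier Ω
  relOpen_elastic : ∃ U : Set (E 3), IsOpen U ∧ Γ = U ∩ frontier Ω
  connected_rigid : IsConnected Γ₀
  connected_elastic : IsConnected Γ
  pos_rigid : 0 < Measure.hausdorffMeasure 2 Γ₀
  pos_elastic : 0 < Measure.hausdorffMeasure 2 Γ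
  flat : Γ ⊆ Set.range e
  edge_eq : closure Γ \ Γ = closure Γ₀ \ Γ₀
  edge_smooth : HasSmoothBoundary (e ⁻¹' Γ)

/-- Real `L²` of a set with Lebesgue measure (functions modulo a.e. equality). -/
abbrev L2 {n : ℕ} (Ω : Set (E n)) : Type := Lp ℝ 2 (volume.restrict Ω)

/-- The classical partial derivative `∂ᵢ φ`. -/
def pderiv {n : ℕ} (i : Fin n) (φ : E n → ℝ) : E n → ℝ :=
  fun x => fderiv ℝ φ x (EuclideanSpace.single i 1)

/-- `φ ∈ C_c^∞(Ω)`. -/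
def IsTest {n : ℕ} (Ω : Set (E n)) (φ : E n → ℝ) : Prop :=
  ContDiff ℝ ∞ φ ∧ HasCompactSupport φ ∧ tsupport φ ⊆ Ω

/-- `v` is the weak partial derivative `∂ᵢ u` in `Ω`. -/
def HasWeakPDeriv {n : ℕ} (Ω : Set (E n)) (i : Fin n) (u v : L2 Ω) : Prop :=
  ∀ φ : E n → ℝ, IsTest Ω φ → ∫ x in Ω, u x * pderiv i φ x = - ∫ x in Ω, v x * φ x

open Classical in
/-- The weak partial derivative `∂ᵢ u ∈ L²(Ω)` (unique when it exists, and `0` by convention when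
it does not; it is only used for functions that have one). -/
def weakPDeriv {n : ℕ} (Ω : Set (E n)) (i : Fin n) (u : L2 Ω) : L2 Ω :=
  if h : ∃ v : L2 Ω, HasWeakPDeriv Ω i u v then h.choose else 0

/-- `H¹(Ω)`. -/
def H1 {n : ℕ} (Ω : Set (E n)) : Set (L2 Ω) :=
  {u | ∀ i, ∃ v : L2 Ω, HasWeakPDeriv Ω i u v}

/-- `H²(Ω)`. -/
def H2 {n : ℕ} (Ω : Set (E n)) : Set (L2 Ω) :=
  {u | u ∈ H1 Ω ∧ ∀ i, weakPDeriv Ω i u ∈ H1 Ω}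

/-- `φₖ → u` in `H¹(Ω)`, for smooth functions `φₖ` and `u ∈ H¹(Ω)`. -/
def TendstoH1 {n : ℕ} (Ω : Set (E n)) (φ : ℕ → E n → ℝ) (u : L2 Ω) : Prop :=
  Tendsto (fun k => eLpNorm (fun x => φ k x - u x) 2 (volume.restrict Ω)) atTop (𝓝 0) ∧
  ∀ i, Tendsto (fun k => eLpNorm (fun x => pderiv i (φ k) x - weakPDeriv Ω i u x) 2
    (volume.restrict Ω)) atTop (𝓝 0)

/-- `φₖ → u` in `H²(Ω)`, for smooth functions `φₖ` and `u ∈ H²(Ω)`. -/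
def TendstoH2 {n : ℕ} (Ω : Set (E n)) (φ : ℕ → E n → ℝ) (u : L2 Ω) : Prop :=
  TendstoH1 Ω φ u ∧ ∀ i, TendstoH1 Ω (fun k => pderiv i (φ k)) (weakPDeriv Ω i u)

/-- The trace of `u ∈ H¹(Ω)` on the part `S` of the boundary of `Ω ⊂ ℝ³` is `t`. The trace operator
is the extension by continuity, from `H¹(Ω)` to `L²` of the surface measure, of the restriction of
functions that are smooth up to the boundary. (The normalization of the two-dimensional Hausdorff
measure is immaterial here.) -/
def HasTrace (Ω S : Set (E 3)) (u : L2 Ω) (t : E 3 → ℝ) : Prop :=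
  ∃ φ : ℕ → E 3 → ℝ, (∀ k, ContDiff ℝ ∞ (φ k)) ∧ TendstoH1 Ω φ u ∧
    Tendsto (fun k => eLpNorm (fun x => φ k x - t x) 2 ((Measure.hausdorffMeasure 2).restrict S))
      atTop (𝓝 0)

/-- `H¹_{Γ₀}(Ω)`: the functions in `H¹(Ω)` whose trace on `Γ₀` vanishes. -/
def H1Gamma0 (Ω Γ₀ : Set (E 3)) : Set (L2 Ω) :=
  {u | u ∈ H1 Ω ∧ HasTrace Ω Γ₀ u 0}

/-- `H²₀(D)`: the closure of `C_c^∞(D)` in `H²(D)`. -/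
def H20 {n : ℕ} (D : Set (E n)) : Set (L2 D) :=
  {w | w ∈ H2 D ∧ ∃ φ : ℕ → E n → ℝ, (∀ k, IsTest D (φ k)) ∧ TendstoH2 D φ w}

/-- `‖∇u‖₂²`. -/
def gradSq {n : ℕ} (Ω : Set (E n)) (u : L2 Ω) : ℝ :=
  ∑ i, ‖weakPDeriv Ω i u‖ ^ 2

/-- The Laplacian `Δw`. -/
def laplacian {n : ℕ} (D : Set (E n)) (w : L2 D) : L2 D :=
  ∑ i, weakPDeriv D i (weakPDeriv D i w)

/-- The energy space `X = H¹_{Γ₀}(Ω) × H²₀(D)`, where `D` is the elastic wall in plane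
coordinates. -/
def X (Ω Γ₀ : Set (E 3)) (D : Set (E 2)) : Set (L2 Ω × L2 D) :=
  H1Gamma0 Ω Γ₀ ×ˢ H20 D

/-- `‖(u,w)‖_X² = ‖∇u‖₂² + |Δw|₂²`. -/
def normXSq (Ω : Set (E 3)) (D : Set (E 2)) (z : L2 Ω × L2 D) : ℝ :=
  gradSq Ω z.1 + ‖laplacian D z.2‖ ^ 2

/-- `∫ |u|^{p+1} log |u|`. -/
def logInt {n : ℕ} (p : ℝ) (Ω : Set (E n)) (u : L2 Ω) : ℝ :=
  ∫ x in Ω, |u x| ^ (p + 1) * Real.log |u x|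

/-- `∫ |u|^{p+1}`, the `(p+1)`-st power of the `L^{p+1}` norm. -/
def powInt {n : ℕ} (p : ℝ) (Ω : Set (E n)) (u : L2 Ω) : ℝ :=
  ∫ x in Ω, |u x| ^ (p + 1)

/-- The potential energy functional. -/
def J (p : ℝ) (Ω : Set (E 3)) (D : Set (E 2)) (z : L2 Ω × L2 D) : ℝ :=
  1 / 2 * normXSq Ω D z - 1 / (p + 1) * (logInt p Ω z.1 + logInt p D z.2)
    + 1 / (p + 1) ^ 2 * (powInt p Ω z.1 + powInt p D z.2)

/-- The Nehari functional. -/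
def I (p : ℝ) (Ω : Set (E 3)) (D : Set (E 2)) (z : L2 Ω × L2 D) : ℝ :=
  normXSq Ω D z - logInt p Ω z.1 - logInt p D z.2

/-- The Nehari manifold. -/
def nehari (p : ℝ) (Ω Γ₀ : Set (E 3)) (D : Set (E 2)) : Set (L2 Ω × L2 D) :=
  {z | z ∈ X Ω Γ₀ D ∧ z ≠ (0, 0) ∧ I p Ω D z = 0}

/-- The depth of the potential well, the infimum of `J` over the Nehari manifold. It is a real
infimum, whose value would be `0` over an empty set or if `J` were unbounded below there. -/
def depth (p : ℝ) (Ω Γ₀ : Set (E 3)) (D : Set (E 2)) : ℝ :=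
  sInf (J p Ω D '' nehari p Ω Γ₀ D)

end StructuralAcoustic

end

noncomputable section

namespace StructuralAcoustic

open MeasureTheory Filter Topology
open scoped ContDiff ENNReal NNReal

/-! On the Nehari manifold `I = 0` eliminates the logarithmic integrals: `J` becomes `(1/2 -
1/(p+1))` times the squared energy norm `N`, plus a nonnegative multiple of the `L^{p+1}` terms.
Since `p > 1`, it suffices to bound `N` away from zero there.

Since `p < 5`, `|s|^{p+1} log |s| ≤ |s|⁶ / (5 - p)`. The Sobolev inequalities `‖u‖₆ ≤ C ‖∇u‖₂` and
`‖w‖₆ ≤ C ‖Δw‖₂` turn `I = 0` into `N ≤ K N³`, and they also show `N > 0` off the origin. Hence `N ≥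
K^{-1/2}` (`exists_le_normXSq_of_mem_nehari`). As the infimum is `0` over the empty set, the
manifold must also be shown nonempty: along a ray `t ↦ (tφ, 0)`, with `φ` a bump function, `I`
vanishes for some `t > 0` by the intermediate value theorem (`nehari_nonempty`).

The inequality for `u` uses the flatness of `Γ` in place of extension operators or compactness. Off
the plane containing `Γ` the boundary lies in `Γ₀`, where the trace of `u` vanishes. On each side of
that plane, `u` extended by zero is therefore weakly differentiable in the whole open half-space
(`weak_integration_by_parts_across`). Mollification reduces the claim to smooth functions on
half-spaces, where folding reduces it to the Gagliardo–Nirenberg–Sobolev inequality on `ℝ³`.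

The inequality for `w` is proved for test functions from `‖∇φ‖² = -∫ φ Δφ` and planar Sobolev
inequalities, and passes to `H²₀` by Fatou's lemma. -/

/-! ### Sobolev inequality on half-spaces, by folding -/

/-- The map that moves `x` along the unit vector `ν` so that its height `t = ⟪ν, x⟫ - b` becomes
`√(t² + δ²)`. -/
def foldMap (ν : E 3) (b δ : ℝ) (x : E 3) : E 3 :=
  x + (Real.sqrt ((inner ℝ ν x - b) ^ 2 + δ ^ 2) - (inner ℝ ν x - b)) • ν

theorem exists_sobolev_const_dim_three :
    ∃ C : ℝ≥0, ∀ v : E 3 → ℝ, ContDiff ℝ 1 v → HasCompactSupport v →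
      eLpNorm v 6 volume ≤ C * eLpNorm (fderiv ℝ v) 2 volume := by
  refine ⟨SNormLESNormFDerivOfEqConst ℝ (volume : Measure (E 3)) 2, fun v hv hv' => ?_⟩
  have := eLpNorm_le_eLpNorm_fderiv_of_eq (μ := (volume : Measure (E 3))) hv hv' (p := 2) (p' := 6)
    (by norm_num) (by simp) (by simp; norm_num)
  exact_mod_cast this

theorem norm_le_norm_foldMap {ν : E 3} (hν : ‖ν‖ = 1) (b δ : ℝ) (x : E 3) :
    ‖x - b • ν‖ ≤ ‖foldMap ν b δ x - b • ν‖ := by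
  have h1 : inner ℝ ν ν = (1 : ℝ) := by rw [real_inner_self_eq_norm_sq, hν]; norm_num
  set t := inner ℝ ν x - b with ht
  set s := Real.sqrt (t ^ 2 + δ ^ 2)
  have hs : s ^ 2 = t ^ 2 + δ ^ 2 := Real.sq_sqrt (by positivity)
  have h2 : inner ℝ (x - b • ν) ν = t := by
    rw [real_inner_comm, inner_sub_right, inner_smul_right, h1, ht]; ring
  have h3 : foldMap ν b δ x - b • ν = (x - b • ν) + (s - t) • ν := by
    simp only [foldMap]; abel
  have h4 : ‖foldMap ν b δ x - b • ν‖ ^ 2 = ‖x - b • ν‖ ^ 2 + δ ^ 2 := by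
    rw [h3, norm_add_sq_real, inner_smul_right, h2, norm_smul, hν, Real.norm_eq_abs, mul_one,
      sq_abs]
    nlinarith
  nlinarith [norm_nonneg (x - b • ν), norm_nonneg (foldMap ν b δ x - b • ν), sq_nonneg δ,
    abs_le_of_sq_le_sq' (a := ‖x - b • ν‖) (b := ‖foldMap ν b δ x - b • ν‖)
      (by nlinarith [sq_nonneg δ]) (norm_nonneg _)]

/-- Folding never brings a point closer to `b • ν`, so one ball works for every `δ`. It carries the
dominating function in the limit `δ → 0`, for which the lemma is applied to the derivative of the
function. -/
theorem exists_radius_comp_foldMap_eq_zero {F : Type*} [Zero F] {ν : E 3} (hν : ‖ν‖ = 1) (b : ℝ)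
    {v : E 3 → F} (hv : HasCompactSupport v) :
    ∃ R : ℝ, ∀ δ : ℝ, ∀ x, R < ‖x - b • ν‖ → v (foldMap ν b δ x) = 0 := by
  obtain ⟨R, hR⟩ := hv.isCompact.isBounded.subset_closedBall (b • ν)
  refine ⟨R, fun δ x hx => ?_⟩
  by_contra h
  have := hR (subset_tsupport _ h)
  rw [Metric.mem_closedBall, dist_eq_norm] at this
  linarith [norm_le_norm_foldMap hν b δ x]

theorem hasFDerivAt_foldMap (ν : E 3) (b : ℝ) {δ : ℝ} (hδ : 0 < δ) (x : E 3) :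
    HasFDerivAt (foldMap ν b δ) (ContinuousLinearMap.id ℝ (E 3) +
      (((inner ℝ ν x - b) / Real.sqrt ((inner ℝ ν x - b) ^ 2 + δ ^ 2) - 1) •
        (innerSL ℝ ν)).smulRight ν) x := by
  have h1 : HasFDerivAt (fun x : E 3 => inner ℝ ν x - b) (innerSL ℝ ν) x :=
    ((innerSL ℝ ν).hasFDerivAt).sub_const b
  have hpos : (inner ℝ ν x - b) ^ 2 + δ ^ 2 ≠ 0 := by positivity
  have h2 := ((h1.pow 2).add_const (δ ^ 2)).sqrt hpos
  have h3 := (hasFDerivAt_id x).add ((h2.sub h1).smul_const ν)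
  convert! h3 using 1
  ext y
  simp
  left
  field_simp

theorem contDiff_foldMap (ν : E 3) (b : ℝ) {δ : ℝ} (hδ : 0 < δ) :
    ContDiff ℝ 1 (foldMap ν b δ) := by
  unfold foldMap
  have h : ContDiff ℝ 1 (fun x : E 3 => inner ℝ ν x - b) :=
    (contDiff_const.inner ℝ contDiff_id).sub contDiff_const
  exact contDiff_id.add ((((h.pow 2).add contDiff_const).sqrt (fun x => by positivity)).sub h
    |>.smul contDiff_const)

/-- The derivative of the fold is the identity plus a rank-one term whose coefficient lies in `[-2,
0]`; the triangle inequality gives `1 + 2 = 3`, which is crude but sufficient. -/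
theorem norm_fderiv_comp_foldMap_le {ν : E 3} (hν : ‖ν‖ = 1) (b : ℝ) {δ : ℝ} (hδ : 0 < δ)
    {v : E 3 → ℝ} (hv : ContDiff ℝ 1 v) (x : E 3) :
    ‖fderiv ℝ (v ∘ foldMap ν b δ) x‖ ≤ 3 * ‖fderiv ℝ v (foldMap ν b δ x)‖ := by
  have h := (hv.differentiable one_ne_zero (foldMap ν b δ x)).hasFDerivAt.comp x
    (hasFDerivAt_foldMap ν b hδ x)
  rw [h.fderiv]
  refine (ContinuousLinearMap.opNorm_comp_le _ _).trans ?_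
  rw [mul_comm]
  gcongr
  refine (norm_add_le _ _).trans ?_
  have h1 : ‖ContinuousLinearMap.id ℝ (E 3)‖ ≤ 1 := ContinuousLinearMap.norm_id_le
  set t := inner ℝ ν x - b
  have h3 : |t / Real.sqrt (t ^ 2 + δ ^ 2)| ≤ 1 := by
    rw [abs_div, abs_of_nonneg (Real.sqrt_nonneg _)]
    apply div_le_one_of_le₀ _ (Real.sqrt_nonneg _)
    rw [← Real.sqrt_sq_eq_abs]
    exact Real.sqrt_le_sqrt (by nlinarith [sq_nonneg δ])
  have h2 : ‖((t / Real.sqrt (t ^ 2 + δ ^ 2) - 1) • (innerSL ℝ ν)).smulRight ν‖ ≤ 2 := by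
    rw [ContinuousLinearMap.norm_smulRight_apply, norm_smul, innerSL_apply_norm, hν, mul_one,
      mul_one, Real.norm_eq_abs]
    have := abs_le.1 h3
    rw [abs_le]; constructor <;> linarith
  linarith

theorem continuous_foldMap_uncurry (ν : E 3) (b : ℝ) :
    Continuous (fun q : ℝ × E 3 => foldMap ν b q.1 q.2) := by
  unfold foldMap
  fun_prop

/-- At `δ = 0` the fold has a crease and is not `C¹`, so the inequality is applied to the smoothed
folds. As `δ → 0`, Fatou's lemma handles the left side and dominated convergence the right. -/
theorem eLpNorm_comp_foldMap_zero_le {C : ℝ≥0} (hC : ∀ v : E 3 → ℝ, ContDiff ℝ 1 v →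
      HasCompactSupport v → eLpNorm v 6 volume ≤ C * eLpNorm (fderiv ℝ v) 2 volume)
    {ν : E 3} (hν : ‖ν‖ = 1) (b : ℝ) {v : E 3 → ℝ} (hv : ContDiff ℝ 1 v)
    (hv' : HasCompactSupport v) :
    eLpNorm (fun x => v (foldMap ν b 0 x)) 6 volume
      ≤ C * (3 * eLpNorm (fun x => fderiv ℝ v (foldMap ν b 0 x)) 2 volume) := by
  set δ : ℕ → ℝ := fun k => 1 / ((k : ℝ) + 1)
  have hδ : ∀ k, 0 < δ k := fun k => by positivity
  have hδ0 : Tendsto δ atTop (𝓝 0) := tendsto_one_div_add_atTop_nhds_zero_nat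
  have hT : ∀ x, Tendsto (fun k => foldMap ν b (δ k) x) atTop (𝓝 (foldMap ν b 0 x)) := fun x =>
    ((continuous_foldMap_uncurry ν b).tendsto (0, x)).comp (hδ0.prodMk_nhds tendsto_const_nhds)
  have hcT : ∀ k, Continuous (foldMap ν b (δ k)) := fun k =>
    (contDiff_foldMap ν b (hδ k)).continuous
  have hDv : Continuous (fderiv ℝ v) := hv.continuous_fderiv one_ne_zero
  have h1 : eLpNorm (fun x => v (foldMap ν b 0 x)) 6 volume
      ≤ liminf (fun k => eLpNorm (fun x => v (foldMap ν b (δ k) x)) 6 volume) atTop :=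
    Lp.eLpNorm_lim_le_liminf_eLpNorm (fun k => (hv.continuous.comp (hcT k)).aestronglyMeasurable) _
      (Eventually.of_forall fun x => (hv.continuous.tendsto _).comp (hT x))
  have h2 : ∀ k, eLpNorm (fun x => v (foldMap ν b (δ k) x)) 6 volume
      ≤ C * (3 * eLpNorm (fun x => fderiv ℝ v (foldMap ν b (δ k) x)) 2 volume) := fun k => by
    obtain ⟨R, hR⟩ := exists_radius_comp_foldMap_eq_zero hν b hv'
    refine (hC (v ∘ foldMap ν b (δ k)) (hv.comp (contDiff_foldMap ν b (hδ k))) ?_).trans ?_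
    · refine HasCompactSupport.intro (isCompact_closedBall (b • ν) R) fun x hx => hR _ x ?_
      simpa [dist_eq_norm] using hx
    · gcongr
      have := eLpNorm_le_nnreal_smul_eLpNorm_of_ae_le_mul (c := 3) (p := 2)
        (μ := (volume : Measure (E 3))) (f := fderiv ℝ (v ∘ foldMap ν b (δ k)))
        (g := fun x => fderiv ℝ v (foldMap ν b (δ k) x))
        (Eventually.of_forall fun x => norm_fderiv_comp_foldMap_le hν b (hδ k) hv x)
      simpa [ENNReal.smul_def] using this
  have h3 : Tendsto (fun k => eLpNorm (fun x => fderiv ℝ v (foldMap ν b (δ k) x)) 2 volume) atTop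
      (𝓝 (eLpNorm (fun x => fderiv ℝ v (foldMap ν b 0 x)) 2 volume)) := by
    obtain ⟨R, hR⟩ := exists_radius_comp_foldMap_eq_zero hν b (hv'.fderiv (𝕜 := ℝ))
    obtain ⟨M, hM⟩ := hDv.bounded_above_of_compact_support (hv'.fderiv (𝕜 := ℝ))
    simp_rw [eLpNorm_eq_lintegral_rpow_enorm_toReal (p := 2) (by norm_num) (by norm_num)]
    refine ((ENNReal.continuous_rpow_const).tendsto _).comp ?_
    refine tendsto_lintegral_of_dominated_convergence
      ((Metric.closedBall (b • ν) R).indicator fun _ => (ENNReal.ofReal M) ^ ((2:ℝ≥0∞).toReal))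
      (fun k => (by fun_prop)) (fun k => Eventually.of_forall fun x => ?_) ?_
      (Eventually.of_forall fun x => ?_)
    · beta_reduce
      by_cases hx : x ∈ Metric.closedBall (b • ν) R
      · rw [Set.indicator_of_mem hx]
        gcongr
        rw [← ofReal_norm]
        exact ENNReal.ofReal_le_ofReal (hM _)
      · have h0 : ‖fderiv ℝ v (foldMap ν b (δ k) x)‖ = 0 := by
          rw [hR (δ k) x (by simpa [dist_eq_norm] using hx)]
          exact norm_zero
        rw [← ofReal_norm, h0, ENNReal.ofReal_zero, ENNReal.zero_rpow_of_pos (by norm_num)]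
        exact zero_le
    · rw [lintegral_indicator_const measurableSet_closedBall]
      exact ENNReal.mul_ne_top (by simp) (measure_closedBall_lt_top).ne
    · refine ((ENNReal.continuous_rpow_const).tendsto _).comp ?_
      exact (hDv.enorm.tendsto _).comp (hT x)
  have h4 := ENNReal.Tendsto.const_mul (a := (C : ℝ≥0∞) * 3) h3 (Or.inr (by finiteness))
  simp only [mul_assoc] at h4
  rw [← h4.liminf_eq]
  exact h1.trans (liminf_le_liminf (Eventually.of_forall h2))

/-- The fold is the identity on the half-space and the reflection `R` in its boundary plane on the
complement; `R` preserves volume, so each half contributes at most the integral over the half-space.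
-/
theorem eLpNorm_fderiv_comp_foldMap_zero_le {F : Type*} [NormedAddCommGroup F] {ν : E 3}
    (hν : ‖ν‖ = 1) (b : ℝ) (G : E 3 → F) :
    eLpNorm (fun x => G (foldMap ν b 0 x)) 2 volume
      ≤ 2 * eLpNorm G 2 (volume.restrict {x | b ≤ inner ℝ ν x}) := by
  set H : Set (E 3) := {x | b ≤ inner ℝ ν x}
  have hH : MeasurableSet H := measurableSet_le measurable_const (by fun_prop)
  have h11 : inner ℝ ν ν = (1 : ℝ) := by rw [real_inner_self_eq_norm_sq, hν]; norm_num
  set R : E 3 → E 3 := fun x => (ℝ ∙ ν)ᗮ.reflection x + (2 * b) • ν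
  have hR : ∀ x, R x = x - (2 * (inner ℝ ν x - b)) • ν := fun x => by
    simp only [R]
    rw [Submodule.reflection_orthogonal_apply, Submodule.reflection_singleton_apply]
    simp [hν]
    module
  have hRm : MeasurePreserving R :=
    (measurePreserving_add_right volume ((2 * b) • ν)).comp
      (LinearIsometryEquiv.measurePreserving _)
  have hRe : MeasurableEmbedding R :=
    (measurableEmbedding_addRight ((2 * b) • ν)).comp
      ((ℝ ∙ ν)ᗮ.reflection.toHomeomorph.measurableEmbedding)
  have h1 : ∀ x ∈ H, foldMap ν b 0 x = x := fun x hx => by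
    have : 0 ≤ inner ℝ ν x - b := sub_nonneg.2 hx
    simp [foldMap, Real.sqrt_sq this]
  have h2 : ∀ x ∈ Hᶜ, foldMap ν b 0 x = R x := fun x hx => by
    have : inner ℝ ν x - b ≤ 0 := by
      have : inner ℝ ν x < b := not_le.1 hx
      linarith
    rw [hR]
    simp only [foldMap]
    rw [show (inner ℝ ν x - b) ^ 2 + 0 ^ 2 = (-(inner ℝ ν x - b)) ^ 2 by ring,
      Real.sqrt_sq (by linarith)]
    module
  have hsub : Hᶜ ⊆ R ⁻¹' H := fun x hx => by
    have : inner ℝ ν x < b := not_le.1 hx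
    simp only [Set.mem_preimage, H, Set.mem_ofPred_eq, hR, inner_sub_right, inner_smul_right, h11]
    linarith
  have e1 : ∫⁻ x in Hᶜ, ‖G (foldMap ν b 0 x)‖ₑ ^ (2:ℝ) ≤ ∫⁻ x in H, ‖G x‖ₑ ^ (2:ℝ) := calc
    _ = ∫⁻ x in Hᶜ, ‖G (R x)‖ₑ ^ (2:ℝ) :=
      setLIntegral_congr_fun hH.compl fun x hx => by simp only [h2 x hx]
    _ ≤ ∫⁻ x in R ⁻¹' H, ‖G (R x)‖ₑ ^ (2:ℝ) := lintegral_mono_set hsub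
    _ = _ := hRm.setLIntegral_comp_preimage_emb hRe (fun x => ‖G x‖ₑ ^ (2:ℝ)) H
  have e2 : ∫⁻ x in H, ‖G (foldMap ν b 0 x)‖ₑ ^ (2:ℝ) = ∫⁻ x in H, ‖G x‖ₑ ^ (2:ℝ) :=
    setLIntegral_congr_fun hH fun x hx => by simp only [h1 x hx]
  rw [eLpNorm_eq_lintegral_rpow_enorm_toReal (p := 2) (by norm_num) (by norm_num),
    eLpNorm_eq_lintegral_rpow_enorm_toReal (p := 2) (by norm_num) (by norm_num)]
  simp only [ENNReal.toReal_ofNat]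
  rw [← lintegral_add_compl _ hH, e2]
  -- The two halves give a factor `2` under the root; rounding it up to `4` avoids `√2` in the
  -- constant.
  calc _ ≤ (4 * ∫⁻ x in H, ‖G x‖ₑ ^ (2:ℝ)) ^ (1 / 2 : ℝ) := by
        gcongr
        calc _ ≤ (∫⁻ x in H, ‖G x‖ₑ ^ (2:ℝ)) + ∫⁻ x in H, ‖G x‖ₑ ^ (2:ℝ) := by gcongr
          _ = 2 * ∫⁻ x in H, ‖G x‖ₑ ^ (2:ℝ) := (two_mul _).symm
          _ ≤ _ := by gcongr; norm_num
    _ = _ := by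
      rw [ENNReal.mul_rpow_of_nonneg _ _ (by norm_num)]
      congr 1
      rw [show (4:ℝ≥0∞) = 2 ^ (2:ℝ) by norm_num, ← ENNReal.rpow_mul]
      norm_num

/-- The Sobolev inequality `‖v‖₆ ≤ C ‖Dv‖₂` on half-spaces of `ℝ³`, with a uniform constant. -/
theorem exists_sobolev_const_halfSpace :
    ∃ C : ℝ≥0, ∀ (ν : E 3) (b : ℝ) (v : E 3 → ℝ), ‖ν‖ = 1 → ContDiff ℝ 1 v →
      HasCompactSupport v →
      eLpNorm v 6 (volume.restrict {x | b ≤ inner ℝ ν x})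
        ≤ C * eLpNorm (fderiv ℝ v) 2 (volume.restrict {x | b ≤ inner ℝ ν x}) := by
  obtain ⟨C, hC⟩ := exists_sobolev_const_dim_three
  refine ⟨C * 6, fun ν b v hν hv hv' => ?_⟩
  have hH : MeasurableSet {x : E 3 | b ≤ inner ℝ ν x} :=
    measurableSet_le measurable_const (by fun_prop)
  calc _ = eLpNorm (fun x => v (foldMap ν b 0 x)) 6 (volume.restrict {x | b ≤ inner ℝ ν x}) := by
        refine eLpNorm_congr_ae ?_
        filter_upwards [ae_restrict_mem hH] with x hx
        have : 0 ≤ inner ℝ ν x - b := sub_nonneg.2 hx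
        simp [foldMap, Real.sqrt_sq this]
    _ ≤ eLpNorm (fun x => v (foldMap ν b 0 x)) 6 volume :=
      eLpNorm_mono_measure _ Measure.restrict_le_self
    _ ≤ _ := eLpNorm_comp_foldMap_zero_le hC hν b hv hv'
    _ ≤ C * (3 * (2 * eLpNorm (fderiv ℝ v) 2 (volume.restrict {x | b ≤ inner ℝ ν x}))) := by
      gcongr
      exact eLpNorm_fderiv_comp_foldMap_zero_le hν b _
    _ = _ := by
      rw [← mul_assoc 3 2, ← mul_assoc]; norm_num

/-! ### From smooth to weakly differentiable functions, by mollification -/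

/-- Averaging against a probability density does not increase the `L²` norm. -/
theorem eLpNorm_integral_mul_translate_le {n : ℕ} {μ : Measure (E n)} [SFinite μ] {ρ G : E n → ℝ}
    (hρ : Continuous ρ) (hρ0 : ∀ x, 0 ≤ ρ x) (hρ1 : ∫⁻ x, ENNReal.ofReal (ρ x) = 1)
    (hμ : μ ≤ volume) (hG : AEStronglyMeasurable G μ) :
    eLpNorm (fun x => ∫ t, G t * ρ (x - t) ∂μ) 2 volume ≤ eLpNorm G 2 μ := by
  rw [eLpNorm_eq_lintegral_rpow_enorm_toReal (p := 2) (by norm_num) (by norm_num),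
    eLpNorm_eq_lintegral_rpow_enorm_toReal (p := 2) (by norm_num) (by norm_num)]
  simp only [ENNReal.toReal_ofNat]
  gcongr ?_ ^ _
  set r : E n → ℝ≥0∞ := fun x => ENNReal.ofReal (ρ x) with hr
  have hrm : Measurable r := hρ.measurable.ennreal_ofReal
  have hr1 : ∀ x, ∫⁻ t, r (x - t) ∂μ ≤ 1 := fun x =>
    (lintegral_mono' hμ le_rfl).trans (by rw [lintegral_sub_left_eq_self r x, hρ1])
  have hr2 : ∀ t, ∫⁻ x, r (x - t) = 1 := fun t => by
    rw [lintegral_sub_right_eq_self r t, hρ1]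
  have key : ∀ x, ‖∫ t, G t * ρ (x - t) ∂μ‖ₑ ^ (2:ℝ) ≤ ∫⁻ t, ‖G t‖ₑ ^ (2:ℝ) * r (x - t) ∂μ := by
    intro x
    have hrx : Measurable (fun t => r (x - t)) := hrm.comp (measurable_const.sub measurable_id)
    -- The density is split as `r = r^{1/2} r^{1/2}` for Cauchy–Schwarz; one factor then has total
    -- mass at most `1`, and Tonelli finishes.
    calc _ ≤ (∫⁻ t, (‖G t‖ₑ * r (x - t) ^ (1 / 2 : ℝ)) * r (x - t) ^ (1 / 2 : ℝ) ∂μ) ^ (2:ℝ) := by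
          gcongr
          refine (enorm_integral_le_lintegral_enorm _).trans (lintegral_mono fun t => ?_)
          rw [enorm_mul, mul_assoc, ← ENNReal.rpow_add_of_nonneg _ _ (by norm_num) (by norm_num)]
          norm_num
          rw [Real.enorm_eq_ofReal (hρ0 _)]
      _ ≤ ((∫⁻ t, (‖G t‖ₑ * r (x - t) ^ (1 / 2 : ℝ)) ^ (2:ℝ) ∂μ) ^ (1 / 2 : ℝ) *
            (∫⁻ t, (r (x - t) ^ (1 / 2 : ℝ)) ^ (2:ℝ) ∂μ) ^ (1 / 2 : ℝ)) ^ (2:ℝ) := by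
          gcongr
          exact ENNReal.lintegral_mul_le_Lp_mul_Lq μ Real.HolderConjugate.two_two
            (hG.enorm.mul (hrx.pow_const _).aemeasurable) (hrx.pow_const _).aemeasurable
      _ = (∫⁻ t, ‖G t‖ₑ ^ (2:ℝ) * r (x - t) ∂μ) * ∫⁻ t, r (x - t) ∂μ := by
          simp_rw [ENNReal.mul_rpow_of_nonneg _ _ (zero_le_two (α := ℝ)), ← ENNReal.rpow_mul]
          norm_num
      _ ≤ _ := mul_le_of_le_one_right zero_le (hr1 x)
  calc _ ≤ ∫⁻ x, ∫⁻ t, ‖G t‖ₑ ^ (2:ℝ) * r (x - t) ∂μ := lintegral_mono key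
    _ = ∫⁻ t, (∫⁻ x, ‖G t‖ₑ ^ (2:ℝ) * r (x - t)) ∂μ := by
      refine lintegral_lintegral_swap ?_
      refine AEMeasurable.mul ?_ (hrm.comp (measurable_fst.sub measurable_snd)).aemeasurable
      exact (hG.enorm.pow_const _).comp_snd
    _ = ∫⁻ t, ‖G t‖ₑ ^ (2:ℝ) ∂μ := by
      refine lintegral_congr fun t => ?_
      have hrt : Measurable (fun x => r (x - t)) := hrm.comp (measurable_id.sub measurable_const)
      rw [lintegral_const_mul _ hrt, hr2, mul_one]

theorem norm_le_sum_norm_apply_single {n : ℕ} (L : E n →L[ℝ] ℝ) :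
    ‖L‖ ≤ ∑ i, ‖L (EuclideanSpace.single i 1)‖ := by
  refine L.opNorm_le_bound (Finset.sum_nonneg fun _ _ => norm_nonneg _) fun x => ?_
  have hx : x = ∑ i, x i • EuclideanSpace.single i (1 : ℝ) := by
    ext j
    simp [Finset.sum_apply, Pi.single_apply]
  conv_lhs => rw [hx, map_sum]
  rw [Finset.sum_mul]
  refine (norm_sum_le _ _).trans (Finset.sum_le_sum fun i _ => ?_)
  rw [map_smul, norm_smul, mul_comm]
  gcongr
  exact PiLp.norm_apply_le x i

theorem eLpNorm_fderiv_le_sum {n : ℕ} {μ : Measure (E n)} {v : E n → ℝ} (hv : ContDiff ℝ 1 v)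
    {p : ℝ≥0∞} (hp : 1 ≤ p) :
    eLpNorm (fderiv ℝ v) p μ ≤ ∑ i, eLpNorm (pderiv i v) p μ := by
  have hc : ∀ i : Fin n, Continuous (pderiv i v) := fun i =>
    (hv.continuous_fderiv one_ne_zero).clm_apply continuous_const
  calc _ ≤ eLpNorm (∑ i, fun x => ‖pderiv i v x‖) p μ := by
        refine eLpNorm_mono_real fun x => ?_
        simpa [pderiv] using norm_le_sum_norm_apply_single (fderiv ℝ v x)
    _ ≤ ∑ i, eLpNorm (fun x => ‖pderiv i v x‖) p μ :=
      eLpNorm_sum_le (fun i _ => (hc i).norm.aestronglyMeasurable) hp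
    _ = _ := by simp only [eLpNorm_norm]

/-- A function on `Ω` with weak gradient `G` tested against functions supported in an open
half-space satisfies the Sobolev inequality there: it behaves as if extended by zero. -/
theorem exists_sobolev_const_of_weak_halfSpace :
    ∃ C : ℝ≥0, ∀ (Ω : Set (E 3)) (u : L2 Ω) (G : Fin 3 → L2 Ω) (ν : E 3) (b : ℝ),
      MeasurableSet Ω → Bornology.IsBounded Ω → ‖ν‖ = 1 →
      (∀ i ψ, IsTest {x | b < inner ℝ ν x} ψ →
        ∫ x in Ω, u x * pderiv i ψ x = - ∫ x in Ω, G i x * ψ x) →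
      eLpNorm u 6 (volume.restrict (Ω ∩ {x | b < inner ℝ ν x}))
        ≤ C * ∑ i, eLpNorm (G i) 2 (volume.restrict Ω) := by
  obtain ⟨C, hC⟩ := exists_sobolev_const_halfSpace
  refine ⟨C, fun Ω u G ν b hΩ hbd hν hw => ?_⟩
  set ε : ℕ → ℝ := fun k => 1 / ((k : ℝ) + 1)
  have hε : ∀ k, 0 < ε k := fun k => by positivity
  have hε0 : Tendsto ε atTop (𝓝 0) := tendsto_one_div_add_atTop_nhds_zero_nat
  let φ : ℕ → ContDiffBump (0 : E 3) := fun k =>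
    ⟨ε k / 2, ε k, by linarith [hε k], by linarith [hε k]⟩
  set ρ : ℕ → E 3 → ℝ := fun k => (φ k).normed volume with hρ
  have hρs : ∀ k, ContDiff ℝ ∞ (ρ k) := fun k => (φ k).contDiff_normed
  have hρc : ∀ k, HasCompactSupport (ρ k) := fun k => (φ k).hasCompactSupport_normed
  set g : E 3 → ℝ := Ω.indicator u with hg
  have : IsFiniteMeasure (volume.restrict Ω) := ⟨by simpa using hbd.measure_lt_top⟩
  have hgi : Integrable g := (integrable_indicator_iff hΩ).2 ((Lp.memLp u).integrable one_le_two)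
  set V : ℕ → E 3 → ℝ := fun k => convolution g (ρ k) (ContinuousLinearMap.mul ℝ ℝ) volume with hV
  have hVa : ∀ k, V k = convolution (ρ k) g (ContinuousLinearMap.lsmul ℝ ℝ) volume := fun k => by
    rw [← convolution_flip]
    simp only [hV]
    congr 1
    ext
    simp
  have hVs : ∀ k, ContDiff ℝ 1 (V k) := fun k =>
    (hρc k).contDiff_convolution_right (n := 1) _ hgi.locallyIntegrable ((hρs k).of_le (by simp))
  have hVc : ∀ k, HasCompactSupport (V k) := fun k => by
    refine HasCompactSupport.convolution _ (HasCompactSupport.of_support_subset_isCompact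
      hbd.isCompact_closure ?_) (hρc k)
    exact (Set.support_indicator_subset).trans subset_closure
  -- At depth `2 ε k` the kernel `ρ k (x - ·)`, supported within `ε k` of `x`, is a test function of
  -- the open half-space. The weak identity thus applies even where this support crosses the
  -- boundary of `Ω`.
  have hVd : ∀ k i x, b + 2 * ε k ≤ inner ℝ ν x →
      pderiv i (V k) x = ∫ t in Ω, G i t * ρ k (x - t) := by
    intro k i x hx
    have h1 : pderiv i (V k) x = ∫ t in Ω, u t * pderiv i (ρ k) (x - t) := by
      rw [pderiv, ((hρc k).hasFDerivAt_convolution_right _ hgi.locallyIntegrable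
        ((hρs k).of_le (by simp)) x).fderiv,
        convolution_precompR_apply (𝕜 := ℝ) _ hgi.locallyIntegrable ((hρc k).fderiv (𝕜 := ℝ))
          ((hρs k).continuous_fderiv (by simp)), convolution_def, ← integral_indicator hΩ]
      congr 1
      ext t
      by_cases ht : t ∈ Ω <;> simp [hg, ht, pderiv]
    have h2 : ∀ t, pderiv i (fun t => ρ k (x - t)) t = - pderiv i (ρ k) (x - t) := fun t => by
      have h := (((hρs k).differentiable (by simp) (x - t)).hasFDerivAt).comp t
        ((hasFDerivAt_id t).const_sub x)
      have h' : HasFDerivAt (fun t => ρ k (x - t)) _ t := h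
      simp only [pderiv]
      rw [h'.fderiv]
      simp
    have hts : IsTest {x | b < inner ℝ ν x} (fun t => ρ k (x - t)) := by
      have hsup : Function.support (fun t => ρ k (x - t)) ⊆ Metric.closedBall x (ε k) := by
        intro t ht
        have : x - t ∈ Function.support (ρ k) := ht
        rw [hρ, ContDiffBump.support_normed_eq] at this
        rw [Metric.mem_closedBall, dist_comm, dist_eq_norm]
        exact (mem_ball_zero_iff.1 this).le
      have hsup' : tsupport (fun t => ρ k (x - t)) ⊆ Metric.closedBall x (ε k) :=
        closure_minimal hsup Metric.isClosed_closedBall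
      refine ⟨(hρs k).comp (contDiff_const.sub contDiff_id),
        HasCompactSupport.of_support_subset_isCompact (isCompact_closedBall _ _) hsup,
        fun t ht => ?_⟩
      have h3 := hsup' ht
      rw [Metric.mem_closedBall, dist_comm, dist_eq_norm] at h3
      have h4 : inner ℝ ν (x - t) ≤ ε k := by
        refine (real_inner_le_norm _ _).trans ?_
        rwa [hν, one_mul]
      rw [inner_sub_right] at h4
      simp only [Set.mem_ofPred_eq]
      linarith [hε k]
    have h5 := hw i _ hts
    simp only [h2, mul_neg, integral_neg, neg_inj] at h5
    rw [h1, h5]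
  set M := ∑ i, eLpNorm (G i) 2 (volume.restrict Ω) with hM
  have hHm : ∀ a : ℝ, MeasurableSet {x : E 3 | a ≤ inner ℝ ν x} := fun a =>
    measurableSet_le measurable_const (by fun_prop)
  -- The half-space moves with `k`; this is why the half-space constant has to be independent of
  -- `b`.
  have hVb : ∀ k, eLpNorm ({x | b + 2 * ε k ≤ inner ℝ ν x}.indicator (V k)) 6 volume ≤ C * M := by
    intro k
    rw [eLpNorm_indicator_eq_eLpNorm_restrict (hHm _)]
    refine (hC ν _ (V k) hν (hVs k) (hVc k)).trans ?_
    gcongr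
    refine (eLpNorm_fderiv_le_sum (hVs k) one_le_two).trans (Finset.sum_le_sum fun i _ => ?_)
    calc _ = eLpNorm (fun x => ∫ t in Ω, G i t * ρ k (x - t)) 2
          (volume.restrict {x | b + 2 * ε k ≤ inner ℝ ν x}) := by
          refine eLpNorm_congr_ae ?_
          filter_upwards [ae_restrict_mem (hHm _)] with x hx using hVd k i x hx
      _ ≤ eLpNorm (fun x => ∫ t in Ω, G i t * ρ k (x - t)) 2 volume :=
          eLpNorm_mono_measure _ Measure.restrict_le_self
      _ ≤ _ := by
          refine eLpNorm_integral_mul_translate_le (hρs k).continuous (φ k).nonneg_normed ?_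
            Measure.restrict_le_self (Lp.aestronglyMeasurable _)
          rw [← ofReal_integral_eq_lintegral_ofReal (φ k).integrable_normed
            (Eventually.of_forall (φ k).nonneg_normed), (φ k).integral_normed, ENNReal.ofReal_one]
  -- Mollifications converge almost everywhere, and each point of the open half-space eventually
  -- lies in the shrunken ones. Fatou's lemma then transfers the uniform `L⁶` bound.
  have hlim : ∀ᵐ x, Tendsto (fun k => {x | b + 2 * ε k ≤ inner ℝ ν x}.indicator (V k) x) atTop
      (𝓝 ({x | b < inner ℝ ν x}.indicator g x)) := by
    have := ContDiffBump.ae_convolution_tendsto_right_of_locallyIntegrable (φ := φ) (l := atTop)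
      (K := 2) (μ := volume) (by simpa [φ] using hε0)
      (Eventually.of_forall fun k => by simp only [φ]; linarith) hgi.locallyIntegrable
    filter_upwards [this] with x hx
    by_cases hb : b < inner ℝ ν x
    · rw [Set.indicator_of_mem (by exact hb)]
      refine hx.congr' ?_
      have : Tendsto (fun k => b + 2 * ε k) atTop (𝓝 b) := by
        simpa using (hε0.const_mul 2).const_add b
      filter_upwards [this.eventually_lt_const hb] with k hk
      rw [Set.indicator_of_mem (by exact hk.le), hVa]
    · rw [Set.indicator_of_notMem (by exact hb)]
      refine tendsto_const_nhds.congr fun k => ?_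
      rw [Set.indicator_of_notMem]
      simp only [Set.mem_ofPred_eq, not_le]
      linarith [hε k]
  have hfin := Lp.eLpNorm_lim_le_liminf_eLpNorm (p := 6)
    (fun k => ((hVs k).continuous.aestronglyMeasurable.indicator (hHm (b + 2 * ε k)))) _ hlim
  have hH' : MeasurableSet {x : E 3 | b < inner ℝ ν x} :=
    measurableSet_lt measurable_const (by fun_prop)
  rw [eLpNorm_indicator_eq_eLpNorm_restrict hH', hg,
    eLpNorm_indicator_eq_eLpNorm_restrict hΩ, Measure.restrict_restrict hΩ] at hfin
  refine hfin.trans ?_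
  exact liminf_le_of_le (by isBoundedDefault) fun a ha => by
    obtain ⟨k, hk⟩ := ha.exists
    exact hk.trans (hVb k)

/-! ### Graph coordinates and the local divergence theorem -/

/-- Appending a last coordinate. -/
def appendCoord (n : ℕ) : E n × ℝ →L[ℝ] E (n + 1) :=
  LinearMap.toContinuousLinearMap
    { toFun := fun q => WithLp.toLp 2 (Fin.snoc (α := fun _ => ℝ) q.1 q.2)
      map_add' := fun p q => by
        ext i
        refine Fin.lastCases ?_ (fun j => ?_) i <;> simp
      map_smul' := fun a q => by
        ext i
        refine Fin.lastCases ?_ (fun j => ?_) i <;> simp }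

@[simp] theorem appendCoord_castSucc {n : ℕ} (q : E n × ℝ) (i : Fin n) :
    appendCoord n q i.castSucc = q.1 i := by
  simp [appendCoord]

@[simp] theorem appendCoord_last {n : ℕ} (q : E n × ℝ) :
    appendCoord n q (Fin.last n) = q.2 := by
  simp [appendCoord]

/-- Dropping the last coordinate. -/
def dropCoord {n : ℕ} (y : E (n + 1)) : E n := WithLp.toLp 2 fun i : Fin n => y i.castSucc

theorem continuous_dropCoord {n : ℕ} : Continuous (dropCoord (n := n)) := by
  unfold dropCoord
  fun_prop

theorem appendCoord_dropCoord {n : ℕ} (y : E (n + 1)) :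
    appendCoord n (dropCoord y, y (Fin.last n)) = y := by
  ext i
  refine Fin.lastCases ?_ (fun j => ?_) i <;> simp [dropCoord]

theorem dropCoord_appendCoord {n : ℕ} (q : E n × ℝ) : dropCoord (appendCoord n q) = q.1 := by
  ext i
  simp [dropCoord]

theorem measurePreserving_appendCoord (n : ℕ) : MeasurePreserving (appendCoord n) := by
  have h1 : MeasurePreserving (Prod.swap : E n × ℝ → ℝ × E n) := Measure.measurePreserving_swap
  have h2 : MeasurePreserving (Prod.map (id : ℝ → ℝ) (@WithLp.ofLp 2 (Fin n → ℝ)))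
      volume volume :=
    (MeasurePreserving.id (volume : Measure ℝ)).prod (PiLp.volume_preserving_ofLp (Fin n))
  have h3 := (volume_preserving_piFinSuccAbove (fun _ : Fin (n + 1) => ℝ) (Fin.last n)).symm
  have h4 := PiLp.volume_preserving_toLp (Fin (n + 1))
  have h5 := h4.comp (h3.comp (h2.comp h1))
  convert! h5 using 1
  ext q i
  refine Fin.lastCases ?_ (fun j => ?_) i <;>
    simp [MeasurableEquiv.piFinSuccAbove, Fin.insertNthEquiv]

theorem measurePreserving_affineIsometryEquiv {n : ℕ} (c : E n ≃ᵃⁱ[ℝ] E n) :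
    MeasurePreserving c := by
  have h : (c : E n → E n) = fun x => c.linearIsometryEquiv x + c 0 := by
    ext1 x
    simpa using c.map_vadd 0 x
  rw [h]
  exact (measurePreserving_add_right volume (c 0)).comp c.linearIsometryEquiv.measurePreserving

/-- Coordinates near a graph: the point at height `q.2` above the graph of `g`, over `q.1`, in the
orthonormal coordinates `c`. -/
def graphChart {n : ℕ} (c : E (n + 1) ≃ᵃⁱ[ℝ] E (n + 1)) (g : E n → ℝ) (hg : Continuous g) :
    E n × ℝ ≃ₜ E (n + 1) where
  toFun q := c.symm (appendCoord n (q.1, g q.1 + q.2))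
  invFun x := (dropCoord (c x), c x (Fin.last n) - g (dropCoord (c x)))
  left_inv q := by simp [dropCoord_appendCoord]
  right_inv x := by simp [appendCoord_dropCoord]
  continuous_toFun := by
    have := c.symm.continuous
    fun_prop
  continuous_invFun := by
    have := c.continuous
    have h := continuous_dropCoord (n := n)
    fun_prop

section Graph

variable {n : ℕ} (c : E (n + 1) ≃ᵃⁱ[ℝ] E (n + 1)) (g : E n → ℝ)

theorem graphChart_apply (hg : Continuous g) (q : E n × ℝ) :
    graphChart c g hg q = c.symm (appendCoord n (q.1, g q.1 + q.2)) := rfl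

theorem graphChart_eq_linear (hg : Continuous g) :
    (graphChart c g hg : E n × ℝ → E (n + 1)) = fun q =>
      c.linearIsometryEquiv.symm (appendCoord n (q.1, g q.1 + q.2)) + c.symm 0 := by
  ext1 q
  have h : c.symm (appendCoord n (q.1, g q.1 + q.2)) =
      c.symm.linearIsometryEquiv (appendCoord n (q.1, g q.1 + q.2)) + c.symm 0 := by
    simpa using c.symm.map_vadd 0 (appendCoord n (q.1, g q.1 + q.2))
  exact h

/-- The chart is a shear followed by isometries. The shear translates each vertical line, so no
Jacobian appears and continuity of `g` is enough. -/
theorem measurePreserving_graphChart (hg : Continuous g) :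
    MeasurePreserving (graphChart c g hg) := by
  have h1 : MeasurePreserving (fun q : E n × ℝ => (id q.1, g q.1 + q.2)) :=
    (MeasurePreserving.id (volume : Measure (E n))).skew_product (by fun_prop)
      (Eventually.of_forall fun y => (measurePreserving_add_left volume (g y)).map_eq)
  exact (measurePreserving_affineIsometryEquiv c.symm).comp
    ((measurePreserving_appendCoord n).comp h1)

theorem hasFDerivAt_graphChart (hg : ContDiff ℝ 1 g) (q : E n × ℝ) :
    HasFDerivAt (graphChart c g hg.continuous)
      ((c.linearIsometryEquiv.symm.toContinuousLinearEquiv : E (n + 1) →L[ℝ] E (n + 1)) ∘L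
        appendCoord n ∘L ((ContinuousLinearMap.fst ℝ (E n) ℝ).prod
          (fderiv ℝ g q.1 ∘L ContinuousLinearMap.fst ℝ (E n) ℝ +
            ContinuousLinearMap.snd ℝ (E n) ℝ))) q := by
  rw [graphChart_eq_linear]
  have h1 := (hg.differentiable one_ne_zero q.1).hasFDerivAt.comp q
    (hasFDerivAt_fst (𝕜 := ℝ) (E := E n) (F := ℝ) (p := q))
  have h2 := (hasFDerivAt_fst (𝕜 := ℝ) (E := E n) (F := ℝ) (p := q)).prodMk
    (h1.add (hasFDerivAt_snd (𝕜 := ℝ) (E := E n) (F := ℝ) (p := q)))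
  have h3 := (appendCoord n).hasFDerivAt.comp q h2
  exact ((c.linearIsometryEquiv.symm.toContinuousLinearEquiv :
    E (n + 1) →L[ℝ] E (n + 1)).hasFDerivAt.comp q h3).add_const _

theorem contDiff_graphChart (hg : ContDiff ℝ 1 g) :
    ContDiff ℝ 1 (graphChart c g hg.continuous) := by
  rw [graphChart_eq_linear]
  refine ContDiff.add ?_ contDiff_const
  exact c.linearIsometryEquiv.symm.contDiff.comp ((appendCoord n).contDiff.comp
    (contDiff_fst.prodMk ((hg.comp contDiff_fst).add contDiff_snd)))

/-- The rate of change, along `v`, of the height above the graph of `g`. -/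
def heightSlope (v : E (n + 1)) (y : E n) : ℝ :=
  c.linearIsometryEquiv v (Fin.last n) - fderiv ℝ g y (dropCoord (c.linearIsometryEquiv v))

theorem continuous_heightSlope (hg : ContDiff ℝ 1 g) (v : E (n + 1)) :
    Continuous (heightSlope c g v) :=
  continuous_const.sub ((hg.continuous_fderiv one_ne_zero).clm_apply continuous_const)

/-- In the chart a constant direction has a constant horizontal part and a vertical part depending
only on the base point. This is the form integrated by parts below. -/
theorem fderiv_apply_graphChart (hg : ContDiff ℝ 1 g) {f : E (n + 1) → ℝ} (hf : ContDiff ℝ 1 f)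
    (v : E (n + 1)) (q : E n × ℝ) :
    fderiv ℝ f (graphChart c g hg.continuous q) v =
      fderiv ℝ (f ∘ graphChart c g hg.continuous) q
        (dropCoord (c.linearIsometryEquiv v), heightSlope c g v q.1) := by
  have h := (hf.differentiable one_ne_zero (graphChart c g hg.continuous q)).hasFDerivAt.comp q
    (hasFDerivAt_graphChart c g hg q)
  rw [h.fderiv]
  simp [heightSlope, appendCoord_dropCoord]

/-- Integration by parts above a graph. -/
theorem integral_indicator_fderiv_above_graph {F : E n × ℝ → ℝ} (hF : ContDiff ℝ 1 F)
    (hFc : HasCompactSupport F) (h : E n) {a : E n → ℝ} (ha : Continuous a) :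
    ∫ q in Set.univ ×ˢ Set.Ioi 0, fderiv ℝ F q (h, a q.1) = - ∫ y, a y * F (y, 0) := by
  have hd : ∀ q : E n × ℝ, fderiv ℝ F q (h, a q.1) =
      fderiv ℝ F q (h, 0) + a q.1 * fderiv ℝ F q (0, 1) := fun q => by
    have : ((h, a q.1) : E n × ℝ) = (h, 0) + a q.1 • (0, 1) := by simp
    rw [this, map_add, map_smul, smul_eq_mul]
  have hDc : Continuous (fderiv ℝ F) := hF.continuous_fderiv one_ne_zero
  have hDs : HasCompactSupport (fderiv ℝ F) := hFc.fderiv (𝕜 := ℝ)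
  have hi1 : Integrable (fun q => fderiv ℝ F q (h, 0)) :=
    (hDc.clm_apply continuous_const).integrable_of_hasCompactSupport
      (hDs.comp_left (g := fun L : E n × ℝ →L[ℝ] ℝ => L (h, 0)) (by simp))
  have hi2 : Integrable (fun q : E n × ℝ => a q.1 * fderiv ℝ F q (0, 1)) :=
    ((ha.comp continuous_fst).mul (hDc.clm_apply continuous_const)).integrable_of_hasCompactSupport
      (HasCompactSupport.mul_left
        (hDs.comp_left (g := fun L : E n × ℝ →L[ℝ] ℝ => L (0, 1)) (by simp)))
  simp_rw [hd]
  rw [integral_add hi1.integrableOn hi2.integrableOn]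
  have hprod : (volume : Measure (E n × ℝ)).restrict (Set.univ ×ˢ Set.Ioi 0) =
      (volume : Measure (E n)).prod (volume.restrict (Set.Ioi (0:ℝ))) := by
    rw [Measure.volume_eq_prod, ← Measure.prod_restrict, Measure.restrict_univ]
  -- On each horizontal slice this is the integral over all of space of a derivative of a compactly
  -- supported function, hence zero. Only the vertical part `e2` yields a boundary term.
  have e1 : ∫ q in Set.univ ×ˢ Set.Ioi 0, fderiv ℝ F q (h, 0) = 0 := by
    have hi := hi1.integrableOn (s := Set.univ ×ˢ Set.Ioi 0)
    rw [IntegrableOn, hprod] at hi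
    rw [hprod, integral_prod_symm _ hi]
    refine integral_eq_zero_of_ae (Eventually.of_forall fun t => ?_)
    have hft : ContDiff ℝ 1 (fun y => F (y, t)) := hF.comp (contDiff_id.prodMk contDiff_const)
    have hfs : HasCompactSupport (fun y => F (y, t)) :=
      hFc.comp_isClosedEmbedding (g := fun y : E n => (y, t))
        (Topology.IsClosedEmbedding.of_continuous_injective_isClosedMap (by fun_prop)
          (fun y z hyz => by simpa using hyz) (isClosedMap_prodMk_right t))
    have hder : ∀ y, fderiv ℝ F (y, t) (h, 0) = fderiv ℝ (fun y => F (y, t)) y h := fun y => by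
      have h1 := (hF.differentiable one_ne_zero (y, t)).hasFDerivAt.comp y
        ((hasFDerivAt_id (𝕜 := ℝ) y).prodMk (hasFDerivAt_const t y))
      have h2 : HasFDerivAt (fun y => F (y, t)) _ y := h1
      rw [h2.fderiv]
      simp
    simp only [hder, Pi.zero_apply]
    have := integral_mul_fderiv_eq_neg_fderiv_mul_of_integrable (μ := (volume : Measure (E n)))
      (f := fun _ => (1:ℝ)) (g := fun y => F (y, t)) (v := h) (by simp)
      (by
        simp only [one_mul]
        exact ((hft.continuous_fderiv one_ne_zero).clm_apply
          continuous_const).integrable_of_hasCompactSupport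
          ((hfs.fderiv (𝕜 := ℝ)).comp_left (g := fun L : E n →L[ℝ] ℝ => L h) (by simp)))
      (by simpa using hft.continuous.integrable_of_hasCompactSupport hfs)
      (fun y _ => by fun_prop) (fun y _ => hft.differentiable one_ne_zero y)
    simpa using this
  have e2 : ∫ q in Set.univ ×ˢ Set.Ioi 0, a q.1 * fderiv ℝ F q (0, 1) = - ∫ y, a y * F (y, 0) := by
    have hi := hi2.integrableOn (s := Set.univ ×ˢ Set.Ioi 0)
    rw [IntegrableOn, hprod] at hi
    rw [hprod, integral_prod _ hi, ← integral_neg]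
    refine integral_congr_ae (Eventually.of_forall fun y => ?_)
    have hft : ContDiff ℝ 1 (fun t => F (y, t)) := hF.comp (contDiff_const.prodMk contDiff_id)
    have hfs : HasCompactSupport (fun t => F (y, t)) :=
      hFc.comp_isClosedEmbedding (g := fun t : ℝ => (y, t))
        (Topology.IsClosedEmbedding.of_continuous_injective_isClosedMap (by fun_prop)
          (fun y z hyz => by simpa using hyz) (isClosedMap_prodMk_left y))
    have hder : ∀ t, fderiv ℝ F (y, t) (0, 1) = deriv (fun t => F (y, t)) t := fun t => by
      have h1 := (hF.differentiable one_ne_zero (y, t)).hasFDerivAt.comp_hasDerivAt t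
        ((hasDerivAt_const t y).prodMk (hasDerivAt_id t))
      exact h1.deriv.symm
    simp only [hder]
    rw [integral_const_mul, hfs.integral_Ioi_deriv_eq hft 0, mul_neg]
  rw [e1, e2, zero_add]

/-- The divergence theorem near a boundary point, in graph coordinates. -/
theorem setIntegral_fderiv_eq_neg_integral_graph (hg : ContDiff ℝ 1 g) {Ω B : Set (E (n + 1))}
    (hΩ : MeasurableSet Ω)
    (hB : ∀ y ∈ B, (y ∈ Ω ↔ g (dropCoord (c y)) < c y (Fin.last n)))
    {f : E (n + 1) → ℝ} (hf : ContDiff ℝ 1 f) (hfc : HasCompactSupport f) (hfB : tsupport f ⊆ B)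
    (v : E (n + 1)) :
    ∫ x in Ω, fderiv ℝ f x v =
      - ∫ y, heightSlope c g v y * f (graphChart c g hg.continuous (y, 0)) := by
  set Φ := graphChart c g hg.continuous with hΦ
  rw [← integral_indicator hΩ,
    ← (measurePreserving_graphChart c g hg.continuous).integral_comp Φ.measurableEmbedding]
  have h1 := integral_indicator_fderiv_above_graph (F := f ∘ Φ)
    (hf.comp (contDiff_graphChart c g hg)) (hfc.comp_homeomorph Φ)
    (dropCoord (c.linearIsometryEquiv v)) (continuous_heightSlope c g hg v)
  simp only [Function.comp_apply] at h1
  rw [← h1, ← integral_indicator (MeasurableSet.univ.prod measurableSet_Ioi)]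
  congr 1
  ext1 q
  -- The graph describes `Ω` only inside `B`; outside the support of `f` both integrands vanish, so
  -- the description is not needed there.
  by_cases hq : Φ q ∈ tsupport f
  · have hmem : Φ q ∈ Ω ↔ q ∈ (Set.univ : Set (E n)) ×ˢ Set.Ioi (0:ℝ) := by
      rw [hB _ (hfB hq)]
      simp [hΦ, graphChart_apply, dropCoord_appendCoord]
    by_cases hqΩ : Φ q ∈ Ω
    · rw [Set.indicator_of_mem hqΩ, Set.indicator_of_mem (hmem.1 hqΩ)]
      exact fderiv_apply_graphChart c g hg hf v q
    · rw [Set.indicator_of_notMem hqΩ, Set.indicator_of_notMem (fun h => hqΩ (hmem.2 h))]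
  · have h0 : fderiv ℝ f (Φ q) = 0 := fderiv_of_notMem_tsupport ℝ hq
    have h2 := fderiv_apply_graphChart c g hg hf v q
    simp only [← hΦ] at h2
    rw [Set.indicator_apply_eq_zero.2 (fun _ => by
      change fderiv ℝ f (Φ q) v = 0
      rw [h0]; rfl)]
    symm
    refine Set.indicator_apply_eq_zero.2 fun _ => ?_
    rw [h0] at h2
    exact h2.symm

end Graph

/-! ### Surface measure and vanishing boundary terms -/

theorem enorm_integral_mul_le_eLpNorm_mul_eLpNorm {α : Type*} [MeasurableSpace α] {μ : Measure α}
    {f g : α → ℝ} (hf : AEStronglyMeasurable f μ) (hg : AEStronglyMeasurable g μ) :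
    ‖∫ x, f x * g x ∂μ‖ₑ ≤ eLpNorm f 2 μ * eLpNorm g 2 μ := by
  refine (enorm_integral_le_lintegral_enorm _).trans ?_
  rw [← eLpNorm_one_eq_lintegral_enorm]
  have h : eLpNorm (f • g) 1 μ ≤ eLpNorm f 2 μ * eLpNorm g 2 μ :=
    eLpNorm_smul_le_mul_eLpNorm (p := 2) (q := 2) hg hf
  exact h

theorem tendsto_integral_mul_of_tendsto_eLpNorm {α : Type*} [MeasurableSpace α] {μ : Measure α}
    {f : ℕ → α → ℝ} {f₀ g : α → ℝ} (hf : ∀ k, AEStronglyMeasurable (f k) μ) (hf₀ : MemLp f₀ 2 μ)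
    (hg : MemLp g 2 μ) (h : Tendsto (fun k => eLpNorm (fun x => f k x - f₀ x) 2 μ) atTop (𝓝 0)) :
    Tendsto (fun k => ∫ x, f k x * g x ∂μ) atTop (𝓝 (∫ x, f₀ x * g x ∂μ)) := by
  rw [tendsto_iff_edist_tendsto_0]
  have h1 : Tendsto (fun k => eLpNorm (fun x => f k x - f₀ x) 2 μ * eLpNorm g 2 μ) atTop (𝓝 0) := by
    simpa using ENNReal.Tendsto.mul_const h (Or.inr hg.2.ne)
  refine tendsto_of_tendsto_of_tendsto_of_le_of_le' tendsto_const_nhds h1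
    (Eventually.of_forall fun _ => zero_le) ?_
  -- Square integrability of `f k` is not assumed; it holds once the distance to `f₀` is finite,
  -- hence for large `k` only.
  filter_upwards [h.eventually_lt_const ENNReal.zero_lt_top] with k hk
  have hd : MemLp (fun x => f k x - f₀ x) 2 μ := ⟨(hf k).sub hf₀.1, hk⟩
  have hfk : MemLp (f k) 2 μ := by
    have := hd.add hf₀
    convert! this using 1
    ext x
    simp
  have hs : ∫ x, f k x * g x ∂μ - ∫ x, f₀ x * g x ∂μ = ∫ x, (f k x - f₀ x) * g x ∂μ := by
    simp_rw [sub_mul]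
    exact (integral_sub (hfk.integrable_mul hg) (hf₀.integrable_mul hg)).symm
  rw [edist_eq_enorm_sub, hs]
  exact enorm_integral_mul_le_eLpNorm_mul_eLpNorm hd.1 hg.1

/-- For the sup norm the Hausdorff measure is Lebesgue measure, and Euclidean distances are no
smaller. One inequality suffices, so the normalizing constant is never computed. -/
theorem volume_le_hausdorffMeasure (n : ℕ) :
    (volume : Measure (E n)) ≤ Measure.hausdorffMeasure n := by
  rw [Measure.le_iff]
  intro s hs
  have h1 : (volume : Measure (E n)) s = (volume : Measure (Fin n → ℝ)) (WithLp.toLp 2 ⁻¹' s) :=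
    ((PiLp.volume_preserving_toLp (Fin n)).measure_preimage hs.nullMeasurableSet).symm
  have h2 : AntilipschitzWith 1 (WithLp.toLp 2 : (Fin n → ℝ) → E n) :=
    PiLp.antilipschitzWith_toLp 2 _
  have h3 := h2.hausdorffMeasure_preimage_le (Nat.cast_nonneg n) s
  have h4 : (Measure.hausdorffMeasure (n : ℝ) : Measure (Fin n → ℝ)) = volume := by
    simpa using hausdorffMeasure_pi_real (ι := Fin n)
  rw [h1, ← h4]
  simpa using h3

theorem norm_dropCoord_le {n : ℕ} (y : E (n + 1)) : ‖dropCoord y‖ ≤ ‖y‖ := by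
  rw [EuclideanSpace.norm_eq, EuclideanSpace.norm_eq]
  refine Real.sqrt_le_sqrt ?_
  rw [Fin.sum_univ_castSucc]
  simp only [dropCoord]
  nlinarith [sq_nonneg ‖y (Fin.last n)‖]

/-- Projecting the graph to its base does not increase distances; hence the base measure is
dominated by the surface measure, without an area formula. -/
theorem antilipschitzWith_graph {n : ℕ} (c : E (n + 1) ≃ᵃⁱ[ℝ] E (n + 1)) (g : E n → ℝ)
    (hg : Continuous g) : AntilipschitzWith 1 (fun y => graphChart c g hg (y, 0)) := by
  refine AntilipschitzWith.of_le_mul_dist fun y z => ?_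
  rw [NNReal.coe_one, one_mul, graphChart_apply, graphChart_apply, c.symm.dist_map, dist_eq_norm,
    dist_eq_norm, ← map_sub]
  refine le_trans (le_of_eq ?_) (norm_dropCoord_le _)
  rw [dropCoord_appendCoord]
  rfl

/-- The Lebesgue integral over the base of a graph is at most the surface integral. -/
theorem lintegral_graph_le {n : ℕ} (c : E (n + 1) ≃ᵃⁱ[ℝ] E (n + 1)) (g : E n → ℝ)
    (hg : Continuous g) {f : E (n + 1) → ℝ≥0∞} (hf : Measurable f) :
    ∫⁻ y, f (graphChart c g hg (y, 0)) ≤ ∫⁻ x, f x ∂(Measure.hausdorffMeasure n) := by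
  have hm : Measurable (fun y : E n => graphChart c g hg (y, 0)) := by
    have := (graphChart c g hg).continuous
    fun_prop
  rw [← lintegral_map hf hm]
  refine lintegral_mono' ?_ le_rfl
  rw [Measure.le_iff]
  intro s hs
  rw [Measure.map_apply hm hs]
  refine (volume_le_hausdorffMeasure n _).trans ?_
  have := (antilipschitzWith_graph c g hg).hausdorffMeasure_preimage_le (Nat.cast_nonneg n) s
  simpa using this

/-- In a graph chart of an open set, the graph belongs to the boundary. -/
theorem graph_mem_frontier {n : ℕ} {Ω : Set (E (n + 1))} {x : E (n + 1)} {r : ℝ}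
    (c : E (n + 1) ≃ᵃⁱ[ℝ] E (n + 1)) (g : E n → ℝ) (hg : Continuous g)
    (hB : ∀ y ∈ Metric.ball x r, (y ∈ Ω ↔ g (dropCoord (c y)) < c y (Fin.last n)))
    {y : E n} (hy : graphChart c g hg (y, 0) ∈ Metric.ball x r) :
    graphChart c g hg (y, 0) ∈ frontier Ω := by
  have hc : Continuous (fun t : ℝ => graphChart c g hg (y, t)) := by
    have := (graphChart c g hg).continuous
    fun_prop
  have hmem : ∀ t : ℝ, graphChart c g hg (y, t) ∈ Metric.ball x r →
      (graphChart c g hg (y, t) ∈ Ω ↔ 0 < t) := fun t ht => by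
    rw [hB _ ht]
    simp [graphChart_apply, dropCoord_appendCoord]
  have hev : ∀ᶠ t in 𝓝 (0:ℝ), graphChart c g hg (y, t) ∈ Metric.ball x r :=
    hc.continuousAt.eventually (Metric.isOpen_ball.mem_nhds hy)
  rw [frontier_eq_closure_inter_closure]
  constructor
  · refine mem_closure_of_tendsto (hc.tendsto 0 |>.mono_left
      (nhdsWithin_le_nhds (s := Set.Ioi 0))) ?_
    filter_upwards [nhdsWithin_le_nhds hev, self_mem_nhdsWithin] with t ht h0
    exact (hmem t ht).2 h0
  · refine subset_closure fun h => ?_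
    exact lt_irrefl _ ((hmem 0 hy).1 h)

/-- If the smooth functions `φ k` tend to zero in `L²` of the part of the boundary that meets the
support of `ψ`, the boundary terms for `φ k * ψ` vanish in the limit. -/
theorem tendsto_setIntegral_fderiv_mul {Ω S : Set (E 3)} (hΩ : MeasurableSet Ω)
    (hS : MeasurableSet S) {x : E 3} {r : ℝ} (c : E 3 ≃ᵃⁱ[ℝ] E 3) {g : E 2 → ℝ}
    (hg : ContDiff ℝ 1 g)
    (hB : ∀ y ∈ Metric.ball x r, (y ∈ Ω ↔ g (dropCoord (c y)) < c y (Fin.last 2)))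
    {ψ : E 3 → ℝ} (hψ : IsTest (Metric.ball x r) ψ) (hψS : frontier Ω ∩ tsupport ψ ⊆ S)
    {φ : ℕ → E 3 → ℝ} (hφ : ∀ k, ContDiff ℝ ∞ (φ k))
    (hlim : Tendsto (fun k => eLpNorm (φ k) 2 ((Measure.hausdorffMeasure 2).restrict S)) atTop
      (𝓝 0)) (v : E 3) :
    Tendsto (fun k => ∫ x in Ω, fderiv ℝ (fun y => φ k y * ψ y) x v) atTop (𝓝 0) := by
  obtain ⟨hψs, hψc, hψB⟩ := hψ
  set Φ := graphChart c g hg.continuous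
  have hΦc : Continuous (fun y : E 2 => Φ (y, 0)) := by
    have := Φ.continuous
    fun_prop
  set W : E 2 → ℝ := fun y => heightSlope c g v y * ψ (Φ (y, 0)) with hW
  have hWc : Continuous W := (continuous_heightSlope c g hg v).mul (hψs.continuous.comp hΦc)
  have hemb : Topology.IsClosedEmbedding (fun y : E 2 => Φ (y, 0)) :=
    Φ.isClosedEmbedding.comp
      (Topology.IsClosedEmbedding.of_continuous_injective_isClosedMap (by fun_prop)
          (fun y z hyz => by simpa using hyz) (isClosedMap_prodMk_right 0))
  have hWs : HasCompactSupport W := HasCompactSupport.mul_left (hψc.comp_isClosedEmbedding hemb)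
  have hWL : MemLp W 2 volume := hWc.memLp_of_hasCompactSupport hWs
  have hWS : ∀ y, W y ≠ 0 → Φ (y, 0) ∈ S := fun y hy => by
    have h1 : Φ (y, 0) ∈ tsupport ψ := subset_tsupport _ (right_ne_zero_of_mul hy)
    exact hψS ⟨graph_mem_frontier c g hg.continuous hB (hψB h1), h1⟩
  -- The indicator of `S` is free: where the weight `W` is nonzero, the graph point is a boundary
  -- point in the support of `ψ`, hence in `S`.
  have heq : ∀ k, ∫ x in Ω, fderiv ℝ (fun y => φ k y * ψ y) x v =
      - ∫ y, W y * S.indicator (φ k) (Φ (y, 0)) := fun k => by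
    rw [setIntegral_fderiv_eq_neg_integral_graph c g hg hΩ hB
      (((hφ k).mul hψs).of_le (by simp)) (HasCompactSupport.mul_left hψc)
      ((tsupport_mul_subset_right).trans hψB)]
    congr 2
    ext y
    by_cases hy : W y = 0
    · rw [hy, zero_mul]
      rcases mul_eq_zero.1 hy with h | h
      · rw [h, zero_mul]
      · change _ * (_ * ψ (Φ (y, 0))) = 0
        rw [h, mul_zero, mul_zero]
    · rw [Set.indicator_of_mem (hWS y hy)]
      simp only [hW, Φ]
      ring
  simp_rw [heq]
  suffices h : Tendsto (fun k => ∫ y, W y * S.indicator (φ k) (Φ (y, 0))) atTop (𝓝 0) by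
    simpa using h.neg
  rw [tendsto_zero_iff_enorm_tendsto_zero]
  have h0 : Tendsto (fun k => eLpNorm W 2 volume *
      eLpNorm (φ k) 2 ((Measure.hausdorffMeasure 2).restrict S)) atTop (𝓝 0) := by
    simpa using ENNReal.Tendsto.const_mul hlim (Or.inr hWL.2.ne)
  refine tendsto_of_tendsto_of_tendsto_of_le_of_le tendsto_const_nhds h0 (fun _ => zero_le)
    fun k => ?_
  have hmeas : Measurable (S.indicator (φ k)) := (hφ k).continuous.measurable.indicator hS
  refine (enorm_integral_mul_le_eLpNorm_mul_eLpNorm hWL.1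
    (hmeas.comp hΦc.measurable).aestronglyMeasurable).trans ?_
  gcongr
  rw [← eLpNorm_indicator_eq_eLpNorm_restrict hS,
    eLpNorm_eq_lintegral_rpow_enorm_toReal (p := 2) (by norm_num) (by norm_num),
    eLpNorm_eq_lintegral_rpow_enorm_toReal (p := 2) (by norm_num) (by norm_num)]
  gcongr ?_ ^ _
  have h := lintegral_graph_le c g hg.continuous
    (f := fun x => ‖S.indicator (φ k) x‖ₑ ^ (ENNReal.toReal 2)) (hmeas.enorm.pow_const _)
  exact_mod_cast h

/-! ### Localization and integration by parts across the vanishing trace -/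

theorem IsTest.mono {n : ℕ} {A B : Set (E n)} {φ : E n → ℝ} (h : IsTest A φ) (hAB : A ⊆ B) :
    IsTest B φ := ⟨h.1, h.2.1, h.2.2.trans hAB⟩

theorem IsTest.mul_left {n : ℕ} {A : Set (E n)} {φ ψ : E n → ℝ} (hψ : IsTest A ψ)
    (hφ : ContDiff ℝ ∞ φ) : IsTest A (φ * ψ) :=
  ⟨hφ.mul hψ.1, hψ.2.1.mul_left, tsupport_mul_subset_right.trans hψ.2.2⟩

theorem contDiff_pderiv {n : ℕ} {φ : E n → ℝ} (hφ : ContDiff ℝ ∞ φ) (i : Fin n) :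
    ContDiff ℝ ∞ (pderiv i φ) := by
  have h : ContDiff ℝ ∞ (fderiv ℝ φ) := hφ.fderiv_right (m := ∞) (by simp)
  exact h.clm_apply contDiff_const

theorem IsTest.pderiv {n : ℕ} {A : Set (E n)} {φ : E n → ℝ} (h : IsTest A φ) (i : Fin n) :
    IsTest A (pderiv i φ) := by
  refine ⟨contDiff_pderiv h.1 i, ?_, ?_⟩
  · exact (h.2.1.fderiv (𝕜 := ℝ)).comp_left
      (g := fun L : E n →L[ℝ] ℝ => L (EuclideanSpace.single i 1)) rfl
  · exact (tsupport_fderiv_apply_subset ℝ _).trans h.2.2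

theorem IsTest.memLp {n : ℕ} {A : Set (E n)} {φ : E n → ℝ} (h : IsTest A φ) (p : ℝ≥0∞)
    (s : Set (E n)) : MemLp φ p (volume.restrict s) :=
  (h.1.continuous.memLp_of_hasCompactSupport h.2.1).restrict s

/-- A functional on test functions that vanishes locally vanishes. -/
theorem eq_zero_of_locally_eq_zero {n : ℕ} {K : Set (E n)} (hK : IsCompact K)
    (T : (E n → ℝ) → ℝ)
    (hT : ∀ φ ψ, IsTest K φ → IsTest K ψ → T (φ - ψ) = T φ - T ψ)
    (hloc : ∀ x ∈ K, ∃ r > 0, ∀ ψ, IsTest (K ∩ Metric.ball x r) ψ → T ψ = 0)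
    {ψ : E n → ℝ} (hψ : IsTest K ψ) : T ψ = 0 := by
  choose! r hr hr0 using hloc
  obtain ⟨t, htK, ht⟩ := hK.elim_nhds_subcover (fun x => Metric.ball x (r x / 2))
    (fun x hx => Metric.ball_mem_nhds x (half_pos (hr x hx)))
  have hbump : ∀ x ∈ K, ∃ b : E n → ℝ, ContDiff ℝ ∞ b ∧ (∀ y ∈ Metric.ball x (r x / 2), b y = 1) ∧
      tsupport b ⊆ Metric.ball x (r x) := fun x hx => by
    have h := hr x hx
    let β : ContDiffBump x := ⟨r x / 2, r x * (3 / 4), by linarith, by linarith⟩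
    refine ⟨β, β.contDiff,
      fun y hy => β.one_of_mem_closedBall (Metric.ball_subset_closedBall hy), ?_⟩
    rw [β.tsupport_eq]
    exact Metric.closedBall_subset_ball (by simp only [β]; linarith)
  choose! b hbs hb1 hbt using hbump
  -- Multiplying by `1 - b a` subtracts a test function supported in one small ball, on which `T`
  -- vanishes; so `T` is unchanged. After all factors of the cover nothing is left, and no partition
  -- of unity is needed.
  have key : ∀ s : Finset (E n), (∀ x ∈ s, x ∈ K) →
      IsTest K ((∏ x ∈ s, (1 - b x)) * ψ) ∧ T ((∏ x ∈ s, (1 - b x)) * ψ) = T ψ := by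
    intro s
    classical
    induction s using Finset.induction_on with
    | empty => intro _; simpa using hψ
    | insert a s ha ih =>
      intro hs
      obtain ⟨h1, h2⟩ := ih fun x hx => hs x (Finset.mem_insert_of_mem hx)
      have haK : a ∈ K := hs a (Finset.mem_insert_self _ _)
      have h3 : IsTest (K ∩ Metric.ball a (r a)) (b a * ((∏ x ∈ s, (1 - b x)) * ψ)) := by
        obtain ⟨q1, q2, q3⟩ := h1.mul_left (hbs a haK)
        exact ⟨q1, q2, Set.subset_inter q3 ((tsupport_mul_subset_left).trans (hbt a haK))⟩
      have h4 : (∏ x ∈ insert a s, (1 - b x)) * ψ =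
          (∏ x ∈ s, (1 - b x)) * ψ - b a * ((∏ x ∈ s, (1 - b x)) * ψ) := by
        rw [Finset.prod_insert ha]; ring
      constructor
      · rw [Finset.prod_insert ha, mul_assoc]
        exact h1.mul_left (contDiff_const.sub (hbs a haK))
      · rw [h4, hT _ _ h1 (h3.mono Set.inter_subset_left), hr0 a haK _ h3, sub_zero, h2]
  have hzero : (∏ x ∈ t, (1 - b x)) * ψ = 0 := by
    ext y
    by_cases hy : y ∈ K
    · obtain ⟨x, hx, hxy⟩ := Set.mem_iUnion₂.1 (ht hy)
      rw [Pi.mul_apply, Finset.prod_apply, Finset.prod_eq_zero hx, zero_mul, Pi.zero_apply]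
      simp [hb1 x (htK x hx) y hxy]
    · rw [Pi.mul_apply, image_eq_zero_of_notMem_tsupport (fun h => hy (hψ.2.2 h)), mul_zero,
        Pi.zero_apply]
  have h0 := (key t htK).2
  rw [hzero] at h0
  rw [← h0]
  -- Subtractivity alone gives `T 0 = T (0 - 0) = 0`.
  have hz : IsTest K (0 : E n → ℝ) := hzero ▸ (key t htK).1
  simpa using hT 0 0 hz hz

theorem hasWeakPDeriv_weakPDeriv {n : ℕ} {Ω : Set (E n)} {u : L2 Ω} (hu : u ∈ H1 Ω) (i : Fin n) :
    HasWeakPDeriv Ω i u (weakPDeriv Ω i u) := by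
  rw [weakPDeriv, dif_pos (hu i)]
  exact (hu i).choose_spec

theorem pderiv_mul {n : ℕ} {φ ψ : E n → ℝ} (hφ : ContDiff ℝ ∞ φ) (hψ : ContDiff ℝ ∞ ψ)
    (i : Fin n) (x : E n) :
    pderiv i (fun y => φ y * ψ y) x = φ x * pderiv i ψ x + pderiv i φ x * ψ x := by
  have h := (hφ.differentiable (by simp) x).hasFDerivAt.mul
    (hψ.differentiable (by simp) x).hasFDerivAt
  have h' : HasFDerivAt (fun y => φ y * ψ y) _ x := h
  simp only [pderiv]
  rw [h'.fderiv]
  simp [mul_comm]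

/-- A function in `H¹(Ω)` whose trace vanishes on `S` is weakly differentiable across `S` when
extended by zero. -/
theorem weak_integration_by_parts_across {Ω S : Set (E 3)} (hΩ : IsOpen Ω)
    (hsm : HasSmoothBoundary Ω) (hS : MeasurableSet S)
    {u : L2 Ω} (hu : u ∈ H1 Ω) (htr : HasTrace Ω S u 0) {ψ : E 3 → ℝ} {O : Set (E 3)}
    (hψ : IsTest O ψ) (hO : frontier Ω ∩ O ⊆ S) (i : Fin 3) :
    ∫ x in Ω, u x * pderiv i ψ x = - ∫ x in Ω, weakPDeriv Ω i u x * ψ x := by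
  have hi : ∀ (w : L2 Ω) (θ : E 3 → ℝ), IsTest (tsupport ψ) θ →
      Integrable (fun x => w x * θ x) (volume.restrict Ω) := fun w θ hθ =>
    (Lp.memLp w).integrable_mul (hθ.memLp 2 Ω)
  suffices h : (fun θ => ∫ x in Ω, u x * pderiv i θ x + weakPDeriv Ω i u x * θ x) ψ = 0 by
    have hψ' : IsTest (tsupport ψ) ψ := ⟨hψ.1, hψ.2.1, subset_rfl⟩
    simp only at h
    rw [integral_add (hi _ _ (hψ'.pderiv i)) (hi _ _ hψ')] at h
    linarith
  refine eq_zero_of_locally_eq_zero hψ.2.1.isCompact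
    (fun θ => ∫ x in Ω, u x * pderiv i θ x + weakPDeriv Ω i u x * θ x) (fun φ₁ φ₂ h₁ h₂ => ?_)
    (fun x hx => ?_)
    ⟨hψ.1, hψ.2.1, subset_rfl⟩
  · beta_reduce
    have hs : ∀ θ, IsTest (tsupport ψ) θ → Integrable
        (fun x => u x * pderiv i θ x + weakPDeriv Ω i u x * θ x) (volume.restrict Ω) :=
      fun θ hθ => (hi _ _ (hθ.pderiv i)).add (hi _ _ hθ)
    rw [← integral_sub (hs _ h₁) (hs _ h₂)]
    congr 1
    ext x
    have : pderiv i (φ₁ - φ₂) x = pderiv i φ₁ x - pderiv i φ₂ x := by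
      simp only [pderiv]
      rw [fderiv_sub (h₁.1.differentiable (by simp) x) (h₂.1.differentiable (by simp) x)]
      rfl
    rw [this, Pi.sub_apply]
    ring
  have hxO : x ∈ O := hψ.2.2 hx
  by_cases hxΩ : x ∈ Ω
  · obtain ⟨r, hr, hrΩ⟩ := Metric.isOpen_iff.1 hΩ x hxΩ
    refine ⟨r, hr, fun θ hθ => ?_⟩
    have hθ' := hθ.mono Set.inter_subset_left
    beta_reduce
    rw [integral_add (hi _ _ (hθ'.pderiv i)) (hi _ _ hθ'), hasWeakPDeriv_weakPDeriv hu i θ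
      (hθ.mono (Set.inter_subset_right.trans hrΩ)), neg_add_cancel]
  by_cases hxc : x ∈ closure Ω
  · have hxf : x ∈ frontier Ω := ⟨hxc, by rwa [hΩ.interior_eq]⟩
    obtain ⟨c, g, r, hg, hr, hB⟩ := hsm x hxf
    refine ⟨r, hr, fun θ hθ => ?_⟩
    have hθ' := hθ.mono Set.inter_subset_left
    obtain ⟨φ, hφ, ⟨hφu, hφd⟩, hφt⟩ := htr
    -- The integrals of `∂ᵢ(φₖ θ)` over `Ω` have two limits: `0`, because the boundary values of
    -- `φₖ` tend to zero on `S`, and the functional at `θ`, by `H¹` convergence and the product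
    -- rule.
    have h1 := tendsto_setIntegral_fderiv_mul hΩ.measurableSet hS c (hg.of_le (by simp)) hB
      (hθ.mono Set.inter_subset_right)
      (fun y hy => hO ⟨hy.1, hψ.2.2 (hθ.2.2 hy.2).1⟩) hφ (by simpa using hφt)
      (EuclideanSpace.single i 1)
    have h2 := tendsto_integral_mul_of_tendsto_eLpNorm (g := pderiv i θ)
      (fun k => (hφ k).continuous.aestronglyMeasurable) (Lp.memLp u)
      ((hθ.pderiv i).memLp 2 Ω) hφu
    have h3 := tendsto_integral_mul_of_tendsto_eLpNorm (g := θ)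
      (fun k => (contDiff_pderiv (hφ k) i).continuous.aestronglyMeasurable)
      (Lp.memLp (weakPDeriv Ω i u)) (hθ.memLp 2 Ω) (hφd i)
    have h4 := h2.add h3
    rw [← integral_add (hi _ _ (hθ'.pderiv i)) (hi _ _ hθ')] at h4
    refine tendsto_nhds_unique h4 (h1.congr fun k => ?_)
    have hloc : ∀ {f η : E 3 → ℝ}, Continuous f → IsTest (tsupport ψ) η →
        Integrable (fun x => f x * η x) (volume.restrict Ω) := fun hf hη =>
      ((hf.mul hη.1.continuous).integrable_of_hasCompactSupport hη.2.1.mul_left).restrict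
    rw [← integral_add (hloc (hφ k).continuous (hθ'.pderiv i))
      (hloc (contDiff_pderiv (hφ k) i).continuous hθ')]
    exact integral_congr_ae (Eventually.of_forall fun y => pderiv_mul (hφ k) hθ.1 i y)
  · obtain ⟨r, hr, hrΩ⟩ := Metric.isOpen_iff.1 isClosed_closure.isOpen_compl x hxc
    refine ⟨r, hr, fun θ hθ => ?_⟩
    refine setIntegral_eq_zero_of_forall_eq_zero fun y hy => ?_
    have hy' : y ∉ Metric.ball x r := fun h => hrΩ h (subset_closure hy)
    have e1 : ∀ {η : E 3 → ℝ}, IsTest (tsupport ψ ∩ Metric.ball x r) η → η y = 0 := fun hη =>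
      image_eq_zero_of_notMem_tsupport fun h => hy' (hη.2.2 h).2
    rw [e1 hθ, e1 (hθ.pderiv i), mul_zero, mul_zero, add_zero]

/-! ### The plane of the elastic wall and the Sobolev inequality in the chamber -/

theorem exists_unit_normal (e : E 2 →ᵃⁱ[ℝ] E 3) :
    ∃ (ν : E 3) (b : ℝ), ‖ν‖ = 1 ∧ Set.range e ⊆ {x | inner ℝ ν x = b} := by
  set V := LinearMap.range e.linearIsometry.toLinearMap
  have hV : V ≠ ⊤ := fun h => by
    have h1 : Module.finrank ℝ V ≤ Module.finrank ℝ (E 2) := LinearMap.finrank_range_le _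
    rw [h, finrank_top] at h1
    simp at h1
  have hV' : Vᗮ ≠ ⊥ := fun h => hV ((Submodule.orthogonal_eq_bot_iff).1 h)
  obtain ⟨w, hw, hw0⟩ := Submodule.exists_mem_ne_zero_of_ne_bot hV'
  refine ⟨(‖w‖⁻¹ : ℝ) • w, inner ℝ ((‖w‖⁻¹ : ℝ) • w) (e 0), ?_, ?_⟩
  · rw [norm_smul, norm_inv, norm_norm, inv_mul_cancel₀ (norm_ne_zero_iff.2 hw0)]
  · rintro _ ⟨y, rfl⟩
    have h1 : e y = e.linearIsometry y + e 0 := by simpa using e.map_vadd 0 y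
    have h2 : inner ℝ w (e.linearIsometry y) = (0:ℝ) :=
      Submodule.inner_left_of_mem_orthogonal (K := V) ⟨y, rfl⟩ hw
    simp only [Set.mem_ofPred_eq]
    rw [h1, inner_add_right, inner_smul_left, h2]
    simp

theorem volume_hyperplane_eq_zero {ν : E 3} (hν : ‖ν‖ = 1) (b : ℝ) :
    volume {x : E 3 | inner ℝ ν x = b} = 0 := by
  have h11 : inner ℝ ν ν = (1 : ℝ) := by rw [real_inner_self_eq_norm_sq, hν]; norm_num
  have h0 : volume {x : E 3 | inner ℝ ν x = 0} = 0 := by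
    have := Measure.addHaar_submodule (volume : Measure (E 3)) (LinearMap.ker (innerₛₗ ℝ ν))
      (fun h => by
        have : ν ∈ LinearMap.ker (innerₛₗ ℝ ν) := h ▸ Submodule.mem_top
        simp at this
        simp [this] at hν)
    convert! this using 2
  rw [← measure_preimage_add_right volume (b • ν)]
  convert! h0 using 3
  ext x
  simp only [Set.mem_preimage, Set.mem_ofPred_eq, inner_add_right, inner_smul_right, h11]
  constructor <;> intro h <;> linarith

/-- The plane between the two sides is null. The second side is written with `-ν` and `-b` so that
the same half-space estimate covers both. -/
theorem eLpNorm_le_add_halfSpaces {Ω : Set (E 3)} {ν : E 3} (hν : ‖ν‖ = 1)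
    (b : ℝ) (u : L2 Ω) :
    eLpNorm u 6 (volume.restrict Ω) ≤
      eLpNorm u 6 (volume.restrict (Ω ∩ {x | b < inner ℝ ν x})) +
      eLpNorm u 6 (volume.restrict (Ω ∩ {x | -b < inner ℝ (-ν) x})) := by
  set A : Set (E 3) := {x | b < inner ℝ ν x}
  set B : Set (E 3) := {x | -b < inner ℝ (-ν) x}
  have hA : MeasurableSet A := measurableSet_lt measurable_const (by fun_prop)
  have hB : MeasurableSet B := measurableSet_lt measurable_const (by fun_prop)
  rw [Set.inter_comm Ω, Set.inter_comm Ω, ← Measure.restrict_restrict hA,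
    ← Measure.restrict_restrict hB, ← eLpNorm_indicator_eq_eLpNorm_restrict hA,
    ← eLpNorm_indicator_eq_eLpNorm_restrict hB]
  have hae : (u : E 3 → ℝ) =ᵐ[volume.restrict Ω] A.indicator u + B.indicator u := by
    have h1 : ∀ᵐ x ∂(volume.restrict Ω), ¬ inner ℝ ν x = b :=
      ae_restrict_of_ae (measure_eq_zero_iff_ae_notMem.1 (volume_hyperplane_eq_zero hν b))
    filter_upwards [h1] with x hx
    rcases lt_or_gt_of_ne hx with h | h
    · have hxB : x ∈ B := by simp only [B, Set.mem_ofPred_eq, inner_neg_left]; linarith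
      have hxA : x ∉ A := by simp only [A, Set.mem_ofPred_eq]; linarith
      simp [hxA, hxB]
    · have hxB : x ∉ B := by simp only [B, Set.mem_ofPred_eq, inner_neg_left]; linarith
      have hxA : x ∈ A := by simp only [A, Set.mem_ofPred_eq]; linarith
      simp [hxA, hxB]
  rw [eLpNorm_congr_ae hae]
  exact eLpNorm_add_le ((Lp.aestronglyMeasurable u).indicator hA)
    ((Lp.aestronglyMeasurable u).indicator hB) (by norm_num)

/-- The plane is closed, so it contains the closure of `Γ`. A point of the closure of `Γ₀` outside
`Γ₀` lies on the common edge, hence in that closure. -/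
theorem IsChamber.frontier_diff_subset {Ω Γ₀ Γ : Set (E 3)} {e : E 2 →ᵃⁱ[ℝ] E 3}
    (h : IsChamber Ω Γ₀ Γ e) : frontier Ω \ Set.range e ⊆ Γ₀ := by
  have hcl : closure Γ ⊆ Set.range e :=
    closure_minimal h.flat e.isometry.isClosedEmbedding.isClosed_range
  rintro x ⟨hx, hxe⟩
  rw [h.boundary_eq, closure_union] at hx
  rcases hx with hx | hx
  · by_contra hx0
    have : x ∈ closure Γ \ Γ := h.edge_eq ▸ ⟨hx, hx0⟩
    exact hxe (hcl this.1)
  · exact absurd (hcl hx) hxe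

theorem IsChamber.measurableSet_rigid {Ω Γ₀ Γ : Set (E 3)} {e : E 2 →ᵃⁱ[ℝ] E 3}
    (h : IsChamber Ω Γ₀ Γ e) : MeasurableSet Γ₀ := by
  obtain ⟨U, hU, rfl⟩ := h.relOpen_rigid
  exact hU.measurableSet.inter isClosed_frontier.measurableSet

/-- The Sobolev inequality for functions whose trace vanishes on the rigid wall. -/
theorem IsChamber.exists_sobolev_const {Ω Γ₀ Γ : Set (E 3)} {e : E 2 →ᵃⁱ[ℝ] E 3}
    (h : IsChamber Ω Γ₀ Γ e) :
    ∃ C : ℝ≥0, ∀ u ∈ H1Gamma0 Ω Γ₀, eLpNorm u 6 (volume.restrict Ω) ≤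
      C * ∑ i, eLpNorm (weakPDeriv Ω i u) 2 (volume.restrict Ω) := by
  obtain ⟨C, hC⟩ := exists_sobolev_const_of_weak_halfSpace
  obtain ⟨ν, b, hν, hP⟩ := exists_unit_normal e
  refine ⟨C + C, fun u hu => ?_⟩
  have hw : ∀ (ν' : E 3) (b' : ℝ), Set.range e ⊆ {x | inner ℝ ν' x = b'} → ∀ i ψ,
      IsTest {x | b' < inner ℝ ν' x} ψ →
        ∫ x in Ω, u x * pderiv i ψ x = - ∫ x in Ω, weakPDeriv Ω i u x * ψ x := by
    intro ν' b' hP' i ψ hψ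
    refine weak_integration_by_parts_across h.isOpen h.smooth h.measurableSet_rigid
      hu.1 hu.2 hψ (fun x hx => h.frontier_diff_subset ⟨hx.1, fun hxe => ?_⟩) i
    have h1 : inner ℝ ν' x = b' := hP' hxe
    have h2 : b' < inner ℝ ν' x := hx.2
    linarith
  refine (eLpNorm_le_add_halfSpaces hν b u).trans ?_
  rw [ENNReal.coe_add, add_mul]
  refine add_le_add (hC Ω u _ ν b h.isOpen.measurableSet h.isBounded hν (hw ν b hP)) ?_
  refine hC Ω u _ (-ν) (-b) h.isOpen.measurableSet h.isBounded (by rwa [norm_neg]) (hw _ _ ?_)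
  intro x hx
  have : inner ℝ ν x = b := hP hx
  simp only [Set.mem_ofPred_eq, inner_neg_left, this]

/-! ### Sobolev inequality for the plate -/

/-- The classical Laplacian on the plane. -/
def planarLaplacian (φ : E 2 → ℝ) : E 2 → ℝ :=
  fun x => pderiv 0 (pderiv 0 φ) x + pderiv 1 (pderiv 1 φ) x

theorem IsTest.support_subset {n : ℕ} {A : Set (E n)} {φ : E n → ℝ} (h : IsTest A φ) :
    Function.support φ ⊆ A := (subset_tsupport φ).trans h.2.2

theorem IsTest.eLpNorm_restrict {n : ℕ} {A : Set (E n)} {φ : E n → ℝ} (h : IsTest A φ) (p : ℝ≥0∞) :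
    eLpNorm φ p (volume.restrict A) = eLpNorm φ p volume :=
  eLpNorm_restrict_eq_of_support_subset h.support_subset

/-- Exponent `2` is critical in the plane. The inequality is therefore used at `3/2`, where `2/3 -
1/2 = 1/6` reaches `L⁶`, and Hölder on the bounded set returns to `L²`, with exponent `2/3 - 1/2`
again. -/
theorem exists_sobolev_const_planar {D : Set (E 2)} (hD : Bornology.IsBounded D) {q : ℝ≥0}
    (hq : (q : ℝ)⁻¹ ≥ 1 / 6) :
    ∃ C : ℝ≥0, ∀ φ, IsTest D φ →
      eLpNorm φ q volume ≤ C * ∑ i, eLpNorm (pderiv i φ) 2 volume := by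
  have hvol : volume D ≠ ⊤ := hD.measure_lt_top.ne
  set C₀ := eLpNormLESNormFDerivOfLeConst ℝ (volume : Measure (E 2)) D (3 / 2) q
  refine ⟨C₀ * (volume D ^ (1 / 6 : ℝ)).toNNReal, fun φ hφ => ?_⟩
  have h1 : eLpNorm φ q volume ≤ C₀ * eLpNorm (fderiv ℝ φ) ((3 / 2 : ℝ≥0) : ℝ≥0∞) volume := by
    refine eLpNorm_le_eLpNorm_fderiv_of_le volume (hφ.1.of_le (by simp)) hφ.support_subset ?_ ?_ ?_ hD
    · rw [← NNReal.coe_le_coe]; norm_num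
    · rw [← NNReal.coe_lt_coe]; simp; norm_num
    · refine le_trans ?_ hq
      simp; norm_num
  have hsub : Function.support (fun x => ‖fderiv ℝ φ x‖) ⊆ D := fun x hx => by
    by_contra h
    refine hx ?_
    beta_reduce
    rw [fderiv_of_notMem_tsupport ℝ fun h' => h (hφ.2.2 h')]
    exact norm_zero
  have hcont : Continuous fun x => ‖fderiv ℝ φ x‖ := (hφ.1.continuous_fderiv (by simp)).norm
  have h2 : eLpNorm (fderiv ℝ φ) ((3 / 2 : ℝ≥0) : ℝ≥0∞) volume ≤
      eLpNorm (fderiv ℝ φ) 2 volume * volume D ^ (1 / 6 : ℝ) := by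
    rw [← eLpNorm_norm (fderiv ℝ φ), ← eLpNorm_norm (fderiv ℝ φ),
      ← eLpNorm_restrict_eq_of_support_subset (p := 2) hsub,
      ← eLpNorm_restrict_eq_of_support_subset (p := ((3 / 2 : ℝ≥0) : ℝ≥0∞)) hsub]
    have hle : ((3 / 2 : ℝ≥0) : ℝ≥0∞) ≤ 2 := by
      rw [show (2 : ℝ≥0∞) = ((2 : ℝ≥0) : ℝ≥0∞) by norm_num, ENNReal.coe_le_coe,
        ← NNReal.coe_le_coe]
      norm_num
    have hexp : 1 / ((3 / 2 : ℝ≥0) : ℝ≥0∞).toReal - 1 / (2 : ℝ≥0∞).toReal = 1 / 6 := by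
      rw [ENNReal.coe_toReal, ENNReal.toReal_ofNat]
      push_cast
      norm_num
    have h := eLpNorm_le_eLpNorm_mul_rpow_measure_univ (μ := volume.restrict D) hle
      hcont.aestronglyMeasurable
    rwa [hexp, Measure.restrict_apply_univ] at h
  have h3 : (((volume D ^ (1 / 6 : ℝ)).toNNReal : ℝ≥0) : ℝ≥0∞) = volume D ^ (1 / 6 : ℝ) :=
    ENNReal.coe_toNNReal (by finiteness)
  calc _ ≤ C₀ * (eLpNorm (fderiv ℝ φ) 2 volume * volume D ^ (1 / 6 : ℝ)) := h1.trans (by gcongr)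
    _ = C₀ * volume D ^ (1 / 6 : ℝ) * eLpNorm (fderiv ℝ φ) 2 volume := by ring
    _ ≤ _ := by
      rw [ENNReal.coe_mul, h3]
      gcongr
      exact eLpNorm_fderiv_le_sum (hφ.1.of_le (by simp)) one_le_two

theorem IsTest.memLp_volume {n : ℕ} {A : Set (E n)} {φ : E n → ℝ} (h : IsTest A φ) (p : ℝ≥0∞) :
    MemLp φ p volume := h.1.continuous.memLp_of_hasCompactSupport h.2.1

theorem toReal_eLpNorm_sq {α : Type*} [MeasurableSpace α] {μ : Measure α} {f : α → ℝ}
    (hf : MemLp f 2 μ) : (eLpNorm f 2 μ).toReal ^ 2 = ∫ x, f x ^ 2 ∂μ := by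
  rw [hf.eLpNorm_eq_integral_rpow_norm (by norm_num) (by norm_num)]
  simp only [ENNReal.toReal_ofNat, Real.norm_eq_abs, Real.rpow_ofNat, sq_abs]
  have h0 : 0 ≤ ∫ x, f x ^ 2 ∂μ := integral_nonneg fun x => sq_nonneg _
  rw [ENNReal.toReal_ofReal (by positivity), ← Real.rpow_natCast, ← Real.rpow_mul h0]
  norm_num

theorem integral_pderiv_sq {n : ℕ} {A : Set (E n)} {φ : E n → ℝ} (h : IsTest A φ) (i : Fin n) :
    ∫ x, pderiv i φ x ^ 2 = - ∫ x, φ x * pderiv i (pderiv i φ) x := by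
  have h1 := h.pderiv i
  have h2 := h1.pderiv i
  have hi : ∀ {f g : E n → ℝ}, IsTest A f → IsTest A g → Integrable (fun x => f x * g x) :=
    fun hf hg => (hf.memLp_volume 2).integrable_mul (hg.memLp_volume 2)
  have := integral_mul_fderiv_eq_neg_fderiv_mul_of_integrable (μ := (volume : Measure (E n)))
    (f := φ) (g := pderiv i φ) (v := EuclideanSpace.single i 1) (hi h1 h1) (hi h h2) (hi h h1)
    (fun x _ => h.1.differentiable (by simp) x) (fun x _ => h1.1.differentiable (by simp) x)
  have h3 : ∫ x, φ x * pderiv i (pderiv i φ) x = - ∫ x, pderiv i φ x * pderiv i φ x := this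
  rw [h3, neg_neg]
  simp_rw [sq]

theorem IsTest.planarLaplacian {A : Set (E 2)} {φ : E 2 → ℝ} (h : IsTest A φ) :
    IsTest A (planarLaplacian φ) := by
  have h0 := (h.pderiv 0).pderiv 0
  have h1 := (h.pderiv 1).pderiv 1
  exact ⟨h0.1.add h1.1, h0.2.1.add h1.2.1,
    (tsupport_add _ _).trans (Set.union_subset h0.2.2 h1.2.2)⟩

/-- The case `q = 2` is a Poincaré inequality. Together with `‖∇φ‖² = -∫ φ Δφ ≤ ‖φ‖ ‖Δφ‖` it bounds
the gradient by the Laplacian, and the case `q = 6` concludes. -/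
theorem exists_sobolev_const_planarLaplacian {D : Set (E 2)} (hD : Bornology.IsBounded D) :
    ∃ C : ℝ≥0, ∀ φ, IsTest D φ →
      eLpNorm φ 6 volume ≤ C * eLpNorm (planarLaplacian φ) 2 volume := by
  obtain ⟨C₂, hC₂⟩ := exists_sobolev_const_planar hD (q := 2) (by norm_num)
  obtain ⟨C₆, hC₆⟩ := exists_sobolev_const_planar hD (q := 6) (by norm_num)
  refine ⟨C₆ * (2 * C₂), fun φ hφ => ?_⟩
  have hΔ := hφ.planarLaplacian
  set a : Fin 2 → ℝ := fun i => (eLpNorm (pderiv i φ) 2 volume).toReal with ha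
  set l : ℝ := (eLpNorm (planarLaplacian φ) 2 volume).toReal with hl
  set m : ℝ := (eLpNorm φ 2 volume).toReal with hm
  have hne : ∀ i, eLpNorm (pderiv i φ) 2 volume ≠ ⊤ := fun i => ((hφ.pderiv i).memLp_volume 2).2.ne
  have hsum : ∑ i, eLpNorm (pderiv i φ) 2 volume = ENNReal.ofReal (∑ i, a i) := by
    rw [ENNReal.ofReal_sum_of_nonneg fun i _ => ENNReal.toReal_nonneg]
    exact Finset.sum_congr rfl fun i _ => (ENNReal.ofReal_toReal (hne i)).symm
  have ha0 : ∀ i, 0 ≤ a i := fun i => ENNReal.toReal_nonneg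
  have hl0 : 0 ≤ l := ENNReal.toReal_nonneg
  have hm0 : 0 ≤ m := ENNReal.toReal_nonneg
  have h1 : m ≤ C₂ * (a 0 + a 1) := by
    have := ENNReal.toReal_mono (by rw [hsum]; finiteness) (hC₂ φ hφ)
    rw [hsum, ENNReal.toReal_mul, ENNReal.toReal_ofReal
      (Finset.sum_nonneg fun i _ => ha0 i), Fin.sum_univ_two] at this
    exact this
  have h2 : a 0 ^ 2 + a 1 ^ 2 ≤ m * l := by
    have hi : ∀ i : Fin 2, Integrable (fun x => φ x * pderiv i (pderiv i φ) x) := fun i =>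
      (hφ.memLp_volume 2).integrable_mul (((hφ.pderiv i).pderiv i).memLp_volume 2)
    have e : a 0 ^ 2 + a 1 ^ 2 = - ∫ x, φ x * planarLaplacian φ x := by
      simp only [ha, toReal_eLpNorm_sq ((hφ.pderiv _).memLp_volume 2), integral_pderiv_sq hφ,
        planarLaplacian, mul_add]
      rw [integral_add (hi 0) (hi 1)]
      ring
    rw [e, hm, hl, ← ENNReal.toReal_mul]
    refine (le_abs_self _).trans ?_
    rw [abs_neg, ← Real.norm_eq_abs, ← toReal_enorm]
    exact ENNReal.toReal_mono
      (ENNReal.mul_ne_top (hφ.memLp_volume 2).2.ne (hΔ.memLp_volume 2).2.ne)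
      (enorm_integral_mul_le_eLpNorm_mul_eLpNorm (hφ.memLp_volume 2).1 (hΔ.memLp_volume 2).1)
  have h3 : a 0 + a 1 ≤ 2 * C₂ * l := by
    -- Here `(a₀ + a₁)² ≤ 2 (a₀² + a₁²) ≤ 2 m l ≤ 2 C₂ (a₀ + a₁) l`; one factor is cancelled unless
    -- it is zero.
    rcases eq_or_lt_of_le (add_nonneg (ha0 0) (ha0 1)) with h0 | h0
    · rw [← h0]; positivity
    · have : (a 0 + a 1) * (a 0 + a 1) ≤ (a 0 + a 1) * (2 * C₂ * l) := by
        nlinarith [sq_nonneg (a 0 - a 1), mul_le_mul_of_nonneg_right h1 hl0]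
      exact le_of_mul_le_mul_left this h0
  refine (hC₆ φ hφ).trans ?_
  rw [ENNReal.coe_mul, mul_assoc]
  gcongr
  rw [hsum, ← ENNReal.ofReal_toReal (hΔ.memLp_volume 2).2.ne, Fin.sum_univ_two,
    ← ENNReal.ofReal_coe_nnreal, ← ENNReal.ofReal_mul (by positivity)]
  exact ENNReal.ofReal_le_ofReal (by simpa using h3)

/-- The Sobolev inequality `‖w‖₆ ≤ C ‖Δw‖₂` on `H²₀` of a bounded planar set. -/
theorem exists_sobolev_const_H20 {D : Set (E 2)} (hD : Bornology.IsBounded D) :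
    ∃ C : ℝ≥0, ∀ w ∈ H20 D, eLpNorm w 6 (volume.restrict D) ≤ C * ‖laplacian D w‖ₑ := by
  obtain ⟨C, hC⟩ := exists_sobolev_const_planarLaplacian hD
  refine ⟨C, fun w hw => ?_⟩
  obtain ⟨-, φ, hφ, ⟨⟨hφ0, -⟩, hφ2⟩⟩ := hw
  set μ := volume.restrict D
  have hlap : (laplacian D w : E 2 → ℝ) =ᵐ[μ] fun x =>
      weakPDeriv D 0 (weakPDeriv D 0 w) x + weakPDeriv D 1 (weakPDeriv D 1 w) x := by
    rw [laplacian, Fin.sum_univ_two]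
    exact Lp.coeFn_add _ _
  have hm : ∀ k, AEStronglyMeasurable (φ k) μ := fun k => (hφ k).1.continuous.aestronglyMeasurable
  have hmd : ∀ k i, AEStronglyMeasurable (pderiv i (pderiv i (φ k))) μ := fun k i =>
    (((hφ k).pderiv i).pderiv i).1.continuous.aestronglyMeasurable
  have hΔ : Tendsto (fun k => eLpNorm (fun x => planarLaplacian (φ k) x - laplacian D w x) 2 μ)
      atTop (𝓝 0) := by
    have hs := ((hφ2 0).2 0).add ((hφ2 1).2 1)
    rw [add_zero] at hs
    refine tendsto_of_tendsto_of_tendsto_of_le_of_le tendsto_const_nhds hs (fun _ => zero_le)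
      fun k => ?_
    refine le_trans (le_of_eq ?_) (eLpNorm_add_le ((hmd k 0).sub (Lp.aestronglyMeasurable _))
      ((hmd k 1).sub (Lp.aestronglyMeasurable _)) one_le_two)
    refine eLpNorm_congr_ae ?_
    filter_upwards [hlap] with x hx
    simp only [hx, planarLaplacian, Pi.add_apply]
    ring
  -- Convergence in `L²` gives an almost everywhere convergent subsequence, which is what Fatou's
  -- lemma in `L⁶` needs.
  obtain ⟨ns, hns, hlim⟩ := (tendstoInMeasure_of_tendsto_eLpNorm two_ne_zero hm
    (Lp.aestronglyMeasurable w) hφ0).exists_seq_tendsto_ae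
  refine (Lp.eLpNorm_lim_le_liminf_eLpNorm (p := 6) (fun k => hm (ns k)) _ hlim).trans ?_
  have hb : ∀ k, eLpNorm (φ (ns k)) 6 μ ≤ C * (eLpNorm (fun x => planarLaplacian (φ (ns k)) x -
      laplacian D w x) 2 μ + ‖laplacian D w‖ₑ) := fun k => by
    refine (eLpNorm_mono_measure _ Measure.restrict_le_self).trans ((hC _ (hφ (ns k))).trans ?_)
    gcongr
    rw [← (hφ (ns k)).planarLaplacian.eLpNorm_restrict, Lp.enorm_def]
    refine le_trans (le_of_eq ?_) (eLpNorm_add_le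
      ((hφ (ns k)).planarLaplacian.1.continuous.aestronglyMeasurable.sub
        (Lp.aestronglyMeasurable (laplacian D w))) (Lp.aestronglyMeasurable _) one_le_two)
    congr 1
    ext x
    simp
  have hlim2 : Tendsto (fun k => C * (eLpNorm (fun x => planarLaplacian (φ (ns k)) x -
      laplacian D w x) 2 μ + ‖laplacian D w‖ₑ)) atTop (𝓝 (C * ‖laplacian D w‖ₑ)) := by
    have := ENNReal.Tendsto.const_mul (a := (C : ℝ≥0∞))
      ((hΔ.comp hns.tendsto_atTop).add_const ‖laplacian D w‖ₑ) (Or.inr ENNReal.coe_ne_top)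
    rwa [zero_add] at this
  rw [← hlim2.liminf_eq]
  exact liminf_le_liminf (Eventually.of_forall hb)

/-! ### Uniqueness of weak derivatives and test functions in the energy space -/

/-- A boundary point belonging to the set satisfies the strict inequality of its chart, an open
condition. This supplies the openness of `Γ` in its plane. -/
theorem HasSmoothBoundary.isOpen {n : ℕ} {Ω : Set (E (n + 1))} (h : HasSmoothBoundary Ω) :
    IsOpen Ω := by
  rw [isOpen_iff_mem_nhds]
  intro x hx
  by_cases hxi : x ∈ interior Ω
  · exact mem_interior_iff_mem_nhds.1 hxi
  obtain ⟨c, g, r, hg, hr, hB⟩ := h x ⟨subset_closure hx, hxi⟩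
  have hc := c.continuous
  have hgc := hg.continuous
  have hd := continuous_dropCoord (n := n)
  have hev : ∀ᶠ y in 𝓝 x, g (dropCoord (c y)) < c y (Fin.last n) := by
    refine (isOpen_lt (f := fun y => g (dropCoord (c y))) (by fun_prop) (by fun_prop)).mem_nhds ?_
    exact (hB x (Metric.mem_ball_self hr)).1 hx
  filter_upwards [hev, Metric.ball_mem_nhds x hr] with y h1 h2
  exact (hB y h2).2 h1

/-- `weakPDeriv` is an arbitrary choice; uniqueness is what allows it to be computed on test
functions and at zero. -/
theorem HasWeakPDeriv.unique {n : ℕ} {Ω : Set (E n)} (hΩ : IsOpen Ω) {i : Fin n} {u v v' : L2 Ω}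
    (h : HasWeakPDeriv Ω i u v) (h' : HasWeakPDeriv Ω i u v') : v = v' := by
  rw [← sub_eq_zero]
  have hloc : LocallyIntegrable (v - v' : L2 Ω) (volume.restrict Ω) :=
    (Lp.memLp (v - v')).locallyIntegrable one_le_two
  have hae := hΩ.ae_eq_zero_of_integral_contDiff_smul_eq_zero
    (hloc.locallyIntegrableOn Ω) (fun φ h1 h2 h3 => by
      have hφ : IsTest Ω φ := ⟨h1, h2, h3⟩
      have hi : ∀ w : L2 Ω, Integrable (fun x => w x * φ x) (volume.restrict Ω) := fun w =>
        (Lp.memLp w).integrable_mul (hφ.memLp 2 Ω)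
      have e1 : ∫ x in Ω, φ x • (v - v' : L2 Ω) x = ∫ x in Ω, (v x * φ x - v' x * φ x) := by
        refine integral_congr_ae ?_
        filter_upwards [Lp.coeFn_sub v v'] with x hx
        rw [hx, Pi.sub_apply, smul_eq_mul]
        ring
      rw [e1, integral_sub (hi v) (hi v')]
      have a1 := h φ hφ
      have a2 := h' φ hφ
      linarith)
  rw [Lp.eq_zero_iff_ae_eq_zero]
  filter_upwards [hae, ae_restrict_mem hΩ.measurableSet] with x hx hxΩ using hx hxΩ

theorem weakPDeriv_eq {n : ℕ} {Ω : Set (E n)} (hΩ : IsOpen Ω) {i : Fin n} {u v : L2 Ω}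
    (h : HasWeakPDeriv Ω i u v) : weakPDeriv Ω i u = v := by
  have hex : ∃ v, HasWeakPDeriv Ω i u v := ⟨v, h⟩
  rw [weakPDeriv, dif_pos hex]
  exact hex.choose_spec.unique hΩ h

/-- The class in `L²(Ω)` of a test function. -/
def IsTest.toL2 {n : ℕ} {Ω : Set (E n)} {φ : E n → ℝ} (h : IsTest Ω φ) : L2 Ω :=
  (h.memLp 2 Ω).toLp φ

theorem IsTest.coeFn_toL2 {n : ℕ} {Ω : Set (E n)} {φ : E n → ℝ} (h : IsTest Ω φ) :
    h.toL2 =ᵐ[volume.restrict Ω] φ := (h.memLp 2 Ω).coeFn_toLp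

theorem IsTest.integral_mul_pderiv {n : ℕ} {Ω : Set (E n)} {φ ψ : E n → ℝ} (h : IsTest Ω φ)
    (hψ : IsTest Ω ψ) (i : Fin n) :
    ∫ x in Ω, φ x * StructuralAcoustic.pderiv i ψ x =
      - ∫ x in Ω, StructuralAcoustic.pderiv i φ x * ψ x := by
  have hi : ∀ {f g : E n → ℝ}, IsTest Ω f → IsTest Ω g → Integrable (fun x => f x * g x) :=
    fun hf hg => (hf.memLp_volume 2).integrable_mul (hg.memLp_volume 2)
  have hz : ∀ {f g : E n → ℝ}, IsTest Ω f → ∫ x in Ω, f x * g x = ∫ x, f x * g x := fun hf =>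
    setIntegral_eq_integral_of_forall_compl_eq_zero fun x hx => by
      rw [Function.notMem_support.1 fun h => hx (hf.support_subset h), zero_mul]
  rw [hz h, hz (h.pderiv i)]
  exact integral_mul_fderiv_eq_neg_fderiv_mul_of_integrable (μ := (volume : Measure (E n)))
    (hi (h.pderiv i) hψ) (hi h (hψ.pderiv i)) (hi h hψ)
    (fun x _ => h.1.differentiable (by simp) x) (fun x _ => hψ.1.differentiable (by simp) x)

theorem IsTest.hasWeakPDeriv {n : ℕ} {Ω : Set (E n)} {φ : E n → ℝ} (h : IsTest Ω φ) (i : Fin n) :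
    HasWeakPDeriv Ω i h.toL2 (h.pderiv i).toL2 := by
  intro ψ hψ
  have e1 : ∫ x in Ω, h.toL2 x * StructuralAcoustic.pderiv i ψ x =
      ∫ x in Ω, φ x * StructuralAcoustic.pderiv i ψ x := by
    refine integral_congr_ae ?_
    filter_upwards [h.coeFn_toL2] with x hx
    rw [hx]
  have e2 : ∫ x in Ω, (h.pderiv i).toL2 x * ψ x =
      ∫ x in Ω, StructuralAcoustic.pderiv i φ x * ψ x := by
    refine integral_congr_ae ?_
    filter_upwards [(h.pderiv i).coeFn_toL2] with x hx
    rw [hx]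
  rw [e1, e2, h.integral_mul_pderiv hψ i]

theorem IsTest.weakPDeriv_toL2 {n : ℕ} {Ω : Set (E n)} (hΩ : IsOpen Ω) {φ : E n → ℝ}
    (h : IsTest Ω φ) (i : Fin n) : weakPDeriv Ω i h.toL2 = (h.pderiv i).toL2 :=
  weakPDeriv_eq hΩ (h.hasWeakPDeriv i)

theorem eLpNorm_sub_eq_zero_of_ae_eq {α : Type*} [MeasurableSpace α] {μ : Measure α} {f g : α → ℝ}
    (h : f =ᵐ[μ] g) (p : ℝ≥0∞) : eLpNorm (fun x => g x - f x) p μ = 0 := by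
  rw [eLpNorm_congr_ae (g := 0) (by filter_upwards [h] with x hx; simp [hx]), eLpNorm_zero]

/-- The constant sequence `φ` witnesses the trace: `S` lies in the boundary of the open set `Ω`,
where `φ` vanishes. -/
theorem IsTest.toL2_mem_H1Gamma0 {Ω S : Set (E 3)} (hΩ : IsOpen Ω) (hS : S ⊆ frontier Ω)
    (hSm : MeasurableSet S) {φ : E 3 → ℝ} (h : IsTest Ω φ) : h.toL2 ∈ H1Gamma0 Ω S := by
  refine ⟨fun i => ⟨_, h.hasWeakPDeriv i⟩, fun _ => φ, fun _ => h.1, ⟨?_, fun i => ?_⟩, ?_⟩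
  · simp only [eLpNorm_sub_eq_zero_of_ae_eq h.coeFn_toL2]
    exact tendsto_const_nhds
  · rw [h.weakPDeriv_toL2 hΩ]
    simp only [eLpNorm_sub_eq_zero_of_ae_eq (h.pderiv i).coeFn_toL2]
    exact tendsto_const_nhds
  · have : (0 : E 3 → ℝ) =ᵐ[(Measure.hausdorffMeasure 2).restrict S] φ := by
      filter_upwards [ae_restrict_mem hSm] with x hx
      have hxΩ : x ∉ Ω := by
        have := (hS hx).2
        rwa [hΩ.interior_eq] at this
      rw [Function.notMem_support.1 fun h' => hxΩ (h.support_subset h'), Pi.zero_apply]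
    simp only [eLpNorm_sub_eq_zero_of_ae_eq this]
    exact tendsto_const_nhds

theorem hasWeakPDeriv_zero {n : ℕ} (D : Set (E n)) (i : Fin n) : HasWeakPDeriv D i 0 0 := by
  have h : ∀ g : E n → ℝ, ∫ x in D, (0 : L2 D) x * g x = 0 := fun g => by
    refine integral_eq_zero_of_ae ?_
    filter_upwards [Lp.coeFn_zero ℝ 2 (volume.restrict D)] with x hx
    rw [hx, Pi.zero_apply, zero_mul]
  intro φ _
  rw [h, h, neg_zero]

theorem weakPDeriv_zero {n : ℕ} {D : Set (E n)} (hD : IsOpen D) (i : Fin n) :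
    weakPDeriv D i 0 = 0 := weakPDeriv_eq hD (hasWeakPDeriv_zero D i)

theorem zero_mem_H1 {n : ℕ} (D : Set (E n)) : (0 : L2 D) ∈ H1 D := fun i =>
  ⟨0, hasWeakPDeriv_zero D i⟩

theorem pderiv_zero {n : ℕ} (i : Fin n) : pderiv i (0 : E n → ℝ) = 0 := by
  ext x
  simp [pderiv]

theorem zero_mem_H20 {n : ℕ} {D : Set (E n)} (hD : IsOpen D) : (0 : L2 D) ∈ H20 D := by
  have hz : TendstoH1 D (fun _ => 0) (0 : L2 D) := by
    have h0 : (fun x => (0 : L2 D) x) =ᵐ[volume.restrict D] (0 : E n → ℝ) :=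
      Lp.coeFn_zero ℝ 2 _
    refine ⟨?_, fun i => ?_⟩
    · simp only [eLpNorm_sub_eq_zero_of_ae_eq h0]
      exact tendsto_const_nhds
    · simp only [weakPDeriv_zero hD, pderiv_zero, eLpNorm_sub_eq_zero_of_ae_eq h0]
      exact tendsto_const_nhds
  refine ⟨⟨zero_mem_H1 D, fun i => ?_⟩, fun _ => 0, fun _ => ⟨contDiff_const, ?_, ?_⟩, hz,
    fun i => ?_⟩
  · rw [weakPDeriv_zero hD]; exact zero_mem_H1 D
  · exact HasCompactSupport.zero
  · simp [tsupport]
  · simpa only [weakPDeriv_zero hD, pderiv_zero] using hz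

theorem laplacian_zero {n : ℕ} {D : Set (E n)} (hD : IsOpen D) : laplacian D (0 : L2 D) = 0 := by
  simp [laplacian, weakPDeriv_zero hD]

theorem logInt_zero {n : ℕ} (p : ℝ) (D : Set (E n)) : logInt p D 0 = 0 := by
  refine integral_eq_zero_of_ae ?_
  filter_upwards [Lp.coeFn_zero ℝ 2 (volume.restrict D)] with x hx
  rw [hx]
  simp

theorem IsTest.gradSq_toL2 {n : ℕ} {Ω : Set (E n)} (hΩ : IsOpen Ω) {φ : E n → ℝ}
    (h : IsTest Ω φ) : gradSq Ω h.toL2 = ∑ i, ∫ x, StructuralAcoustic.pderiv i φ x ^ 2 := by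
  refine Finset.sum_congr rfl fun i _ => ?_
  rw [h.weakPDeriv_toL2 hΩ, IsTest.toL2, Lp.norm_toLp, (h.pderiv i).eLpNorm_restrict,
    toReal_eLpNorm_sq ((h.pderiv i).memLp_volume 2)]

/-! ### Energy estimates on the Nehari manifold and its nonemptiness -/

/-- `|s|^{p+1} log |s| ≤ |s|⁶ / (5 - p)`. -/
theorem rpow_mul_log_le {p : ℝ} (hp5 : p < 5) {s : ℝ} (hs : 0 ≤ s) :
    s ^ (p + 1) * Real.log s ≤ s ^ 6 / (5 - p) := by
  rcases hs.eq_or_lt with rfl | hs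
  · simp
  -- The exponent `5 - p` is the one that lifts `p + 1` to the Sobolev exponent `6`.
  have h := Real.log_le_rpow_div hs.le (sub_pos.2 hp5)
  calc _ ≤ s ^ (p + 1) * (s ^ (5 - p) / (5 - p)) := by gcongr
    _ = s ^ 6 / (5 - p) := by
      rw [← mul_div_assoc, ← Real.rpow_add hs, ← Real.rpow_natCast]
      congr 2
      push_cast
      ring

theorem logInt_le {n : ℕ} {p : ℝ} (hp5 : p < 5) {Ω : Set (E n)} {u : L2 Ω} {M : ℝ}
    (hM : 0 ≤ M) (h : eLpNorm u 6 (volume.restrict Ω) ≤ ENNReal.ofReal M) :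
    logInt p Ω u ≤ M ^ 6 / (5 - p) := by
  have hm : MemLp u 6 (volume.restrict Ω) :=
    ⟨Lp.aestronglyMeasurable u, h.trans_lt ENNReal.ofReal_lt_top⟩
  have hi : Integrable (fun x => |u x| ^ 6) (volume.restrict Ω) := by
    have h := hm.integrable_norm_rpow (by norm_num) (by norm_num)
    simpa only [ENNReal.toReal_ofNat, Real.norm_eq_abs, Real.rpow_ofNat] using h
  have h6 : ∫ x in Ω, |u x| ^ 6 ≤ M ^ 6 := by
    have h0 : 0 ≤ ∫ x in Ω, |u x| ^ 6 := integral_nonneg fun x => by positivity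
    rw [hm.eLpNorm_eq_integral_rpow_norm (by norm_num) (by norm_num),
      ENNReal.ofReal_le_ofReal_iff hM] at h
    simp only [ENNReal.toReal_ofNat, Real.norm_eq_abs, Real.rpow_ofNat] at h
    calc ∫ x in Ω, |u x| ^ 6 = ((∫ x in Ω, |u x| ^ 6) ^ (6⁻¹ : ℝ)) ^ 6 := by
          rw [← Real.rpow_natCast, ← Real.rpow_mul h0]; norm_num
      _ ≤ M ^ 6 := by gcongr
  have h5 : 0 < 5 - p := sub_pos.2 hp5
  calc logInt p Ω u ≤ ∫ x in Ω, |u x| ^ 6 / (5 - p) := by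
        -- A non-integrable integrand has integral `0` by convention, and the bound still holds
        -- because its right side is nonnegative.
        by_cases hint : Integrable (fun x => |u x| ^ (p + 1) * Real.log |u x|) (volume.restrict Ω)
        · exact integral_mono hint (hi.div_const _) fun x => rpow_mul_log_le hp5 (abs_nonneg _)
        · rw [logInt, integral_undef hint]
          exact integral_nonneg fun x => by positivity
    _ = (∫ x in Ω, |u x| ^ 6) / (5 - p) := integral_div _ _
    _ ≤ _ := by gcongr

theorem sum_enorm_weakPDeriv_le {n : ℕ} (Ω : Set (E n)) (u : L2 Ω) :
    ∑ i, eLpNorm (weakPDeriv Ω i u) 2 (volume.restrict Ω) ≤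
      ENNReal.ofReal (n * Real.sqrt (gradSq Ω u)) := by
  have h1 : ∀ i, eLpNorm (weakPDeriv Ω i u) 2 (volume.restrict Ω) ≤
      ENNReal.ofReal (Real.sqrt (gradSq Ω u)) := fun i => by
    rw [← Lp.enorm_def, ← ofReal_norm]
    refine ENNReal.ofReal_le_ofReal (Real.le_sqrt_of_sq_le ?_)
    exact Finset.single_le_sum (f := fun i => ‖weakPDeriv Ω i u‖ ^ 2) (fun i _ => sq_nonneg _)
      (Finset.mem_univ i)
  refine (Finset.sum_le_sum fun i _ => h1 i).trans (le_of_eq ?_)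
  rw [Finset.sum_const, Finset.card_univ, Fintype.card_fin, nsmul_eq_mul,
    ENNReal.ofReal_mul (Nat.cast_nonneg n), ENNReal.ofReal_natCast]

theorem gradSq_nonneg {n : ℕ} (Ω : Set (E n)) (u : L2 Ω) : 0 ≤ gradSq Ω u :=
  Finset.sum_nonneg fun _ _ => sq_nonneg _

theorem powInt_nonneg {n : ℕ} (p : ℝ) (Ω : Set (E n)) (u : L2 Ω) : 0 ≤ powInt p Ω u :=
  integral_nonneg fun x => by positivity

theorem eq_zero_of_eLpNorm_eq_zero {n : ℕ} {Ω : Set (E n)} {u : L2 Ω} {p : ℝ≥0∞} (hp : p ≠ 0)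
    (h : eLpNorm u p (volume.restrict Ω) = 0) : u = 0 :=
  (Lp.eq_zero_iff_ae_eq_zero).2 ((eLpNorm_eq_zero_iff (Lp.aestronglyMeasurable u) hp).1 h)

/-- On the Nehari manifold the energy norm is bounded below. -/
theorem exists_le_normXSq_of_mem_nehari {Ω Γ₀ : Set (E 3)} {D : Set (E 2)} {C₁ C₂ : ℝ≥0}
    (hC₁ : ∀ u ∈ H1Gamma0 Ω Γ₀, eLpNorm u 6 (volume.restrict Ω) ≤
      C₁ * ∑ i, eLpNorm (weakPDeriv Ω i u) 2 (volume.restrict Ω))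
    (hC₂ : ∀ w ∈ H20 D, eLpNorm w 6 (volume.restrict D) ≤ C₂ * ‖laplacian D w‖ₑ)
    {p : ℝ} (hp5 : p < 5) :
    ∃ δ > 0, ∀ z ∈ nehari p Ω Γ₀ D, δ ≤ normXSq Ω D z := by
  -- The constant of `N ≤ K N³`; the factor `3` counts partial derivatives, and the added `1` keeps
  -- `K` positive when both Sobolev constants vanish.
  set K : ℝ := ((C₁ * 3) ^ 6 + C₂ ^ 6) / (5 - p) + 1
  have h5 : 0 < 5 - p := sub_pos.2 hp5
  have hK : 0 < K := by positivity
  refine ⟨Real.sqrt (1 / K), by positivity, ?_⟩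
  rintro ⟨u, w⟩ ⟨⟨hu, hw⟩, hz, hI⟩
  simp only at hu hw
  set N := normXSq Ω D (u, w) with hN
  have hg0 := gradSq_nonneg Ω u
  have hNe : N = gradSq Ω u + ‖laplacian D w‖ ^ 2 := rfl
  have hu6 : eLpNorm u 6 (volume.restrict Ω) ≤
      ENNReal.ofReal (C₁ * (3 * Real.sqrt (gradSq Ω u))) := by
    refine (hC₁ u hu).trans ?_
    rw [ENNReal.ofReal_mul C₁.coe_nonneg, ENNReal.ofReal_coe_nnreal]
    gcongr
    simpa using sum_enorm_weakPDeriv_le Ω u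
  have hw6 : eLpNorm w 6 (volume.restrict D) ≤ ENNReal.ofReal (C₂ * ‖laplacian D w‖) := by
    refine (hC₂ w hw).trans ?_
    rw [ENNReal.ofReal_mul C₂.coe_nonneg, ENNReal.ofReal_coe_nnreal, ofReal_norm]
  have hN0 : 0 < N := by
    have hNn : 0 ≤ N := by rw [hNe]; positivity
    refine hNn.lt_of_ne fun h0 => hz ?_
    have e1 : gradSq Ω u = 0 := by nlinarith [sq_nonneg ‖laplacian D w‖]
    have e2 : ‖laplacian D w‖ = 0 := by
      have : ‖laplacian D w‖ ^ 2 = 0 := by nlinarith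
      simpa using this
    rw [e1] at hu6
    rw [e2] at hw6
    simp only [Real.sqrt_zero, mul_zero, ENNReal.ofReal_zero, nonpos_iff_eq_zero] at hu6 hw6
    rw [eq_zero_of_eLpNorm_eq_zero (by norm_num) hu6, eq_zero_of_eLpNorm_eq_zero (by norm_num) hw6]
  have h1 := logInt_le hp5 (by positivity) hu6
  have h2 := logInt_le hp5 (by positivity) hw6
  have h3 : N = logInt p Ω u + logInt p D w := by
    have : N - logInt p Ω u - logInt p D w = 0 := hI
    linarith
  have e1 : (C₁ * (3 * Real.sqrt (gradSq Ω u))) ^ 6 ≤ ((C₁:ℝ) * 3) ^ 6 * N ^ 3 := by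
    have : (C₁ * (3 * Real.sqrt (gradSq Ω u))) ^ 6 = ((C₁:ℝ) * 3) ^ 6 * gradSq Ω u ^ 3 := by
      rw [← mul_assoc, mul_pow]
      congr 1
      rw [show 6 = 2 * 3 by norm_num, pow_mul, Real.sq_sqrt hg0]
    rw [this]
    gcongr
    rw [hNe]
    exact le_add_of_nonneg_right (sq_nonneg _)
  have e2 : (C₂ * ‖laplacian D w‖) ^ 6 ≤ (C₂:ℝ) ^ 6 * N ^ 3 := by
    rw [mul_pow, show ‖laplacian D w‖ ^ 6 = (‖laplacian D w‖ ^ 2) ^ 3 by rw [← pow_mul]]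
    gcongr
    rw [hNe]
    exact le_add_of_nonneg_left hg0
  have h4 : N ≤ K * N ^ 3 := by
    have a1 := h1.trans (div_le_div_of_nonneg_right e1 h5.le)
    have a2 := h2.trans (div_le_div_of_nonneg_right e2 h5.le)
    have : K * N ^ 3 = ((C₁:ℝ) * 3) ^ 6 * N ^ 3 / (5 - p) + (C₂:ℝ) ^ 6 * N ^ 3 / (5 - p) + N ^ 3 := by
      simp only [K]; ring
    have : 0 < N ^ 3 := by positivity
    linarith
  rw [Real.sqrt_le_left hN0.le, div_le_iff₀ hK]
  nlinarith

/-- Every ray spanned by a nonzero test function meets the Nehari manifold. -/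
theorem nehari_nonempty {Ω Γ₀ : Set (E 3)} {D : Set (E 2)} (hΩ : IsOpen Ω) (hne : Ω.Nonempty)
    (hD : IsOpen D) (hS : Γ₀ ⊆ frontier Ω) (hSm : MeasurableSet Γ₀) {C₁ : ℝ≥0}
    (hC₁ : ∀ u ∈ H1Gamma0 Ω Γ₀, eLpNorm u 6 (volume.restrict Ω) ≤
      C₁ * ∑ i, eLpNorm (weakPDeriv Ω i u) 2 (volume.restrict Ω))
    {p : ℝ} (hp1 : 1 < p) : (nehari p Ω Γ₀ D).Nonempty := by
  obtain ⟨x₀, hx₀⟩ := hne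
  obtain ⟨r, hr, hrΩ⟩ := Metric.isOpen_iff.1 hΩ x₀ hx₀
  let β : ContDiffBump x₀ := ⟨r / 4, r / 2, by linarith, by linarith⟩
  set φ : E 3 → ℝ := ⇑β
  have hφ : IsTest Ω φ := by
    refine ⟨β.contDiff, β.hasCompactSupport, ?_⟩
    rw [β.tsupport_eq]
    exact (Metric.closedBall_subset_ball (by simp only [β]; linarith)).trans hrΩ
  have hφx : φ x₀ = 1 := β.one_of_mem_closedBall (Metric.mem_closedBall_self β.rIn_pos.le)
  have hscale : ∀ t : ℝ, IsTest Ω (fun x => t * φ x) := fun t =>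
    hφ.mul_left (φ := fun _ => t) contDiff_const
  have hcpow : Continuous fun x => |φ x| ^ (p + 1) :=
    hφ.1.continuous.abs.rpow_const fun _ => Or.inr (by linarith)
  -- Continuity at the zeros of `φ` comes from splitting off `s log s`, which is continuous at `0`.
  have hclog : Continuous fun x => |φ x| ^ (p + 1) * Real.log |φ x| := by
    have : (fun x => |φ x| ^ (p + 1) * Real.log |φ x|) =
        fun x => |φ x| ^ p * (|φ x| * Real.log |φ x|) := by
      ext x
      rcases (abs_nonneg (φ x)).eq_or_lt with h | h
      · rw [← h]; simp
      · rw [Real.rpow_add_one h.ne']; ring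
    rw [this]
    exact (hφ.1.continuous.abs.rpow_const fun _ => Or.inr (by linarith)).mul
      (Real.continuous_mul_log.comp hφ.1.continuous.abs)
  have hp0 : p + 1 ≠ 0 := by linarith
  have hspow : HasCompactSupport fun x => |φ x| ^ (p + 1) :=
    hφ.2.1.comp_left (g := fun s : ℝ => |s| ^ (p + 1)) (by simp [hp0])
  have hslog : HasCompactSupport fun x => |φ x| ^ (p + 1) * Real.log |φ x| :=
    HasCompactSupport.mul_right hspow
  have hipow := (hcpow.integrable_of_hasCompactSupport hspow (μ := volume)).restrict (s := Ω)
  have hilog := (hclog.integrable_of_hasCompactSupport hslog (μ := volume)).restrict (s := Ω)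
  set A : ℝ := ∑ i, ∫ x, pderiv i φ x ^ 2 with hA
  set B : ℝ := ∫ x in Ω, |φ x| ^ (p + 1) with hB
  set L : ℝ := ∫ x in Ω, |φ x| ^ (p + 1) * Real.log |φ x| with hL
  have hφ0 : hφ.toL2 ≠ 0 := fun h0 => by
    have h1 : φ =ᵐ[volume.restrict Ω] 0 :=
      hφ.coeFn_toL2.symm.trans ((Lp.eq_zero_iff_ae_eq_zero).1 h0)
    have h2 : φ =ᵐ[volume] 0 := by
      have := (ae_restrict_iff' hΩ.measurableSet).1 h1
      filter_upwards [this] with x hx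
      by_cases hxΩ : x ∈ Ω
      · exact hx hxΩ
      · exact Function.notMem_support.1 fun h' => hxΩ (hφ.support_subset h')
    have h3 := (hφ.1.continuous.ae_eq_iff_eq volume continuous_zero).1 h2
    rw [h3] at hφx
    simp at hφx
  have hB0 : 0 < B := by
    have : B = ∫ x, |φ x| ^ (p + 1) := setIntegral_eq_integral_of_forall_compl_eq_zero fun x hx => by
      rw [Function.notMem_support.1 fun h' => hx (hφ.support_subset h')]
      simp [hp0]
    rw [this]
    exact hcpow.integral_pos_of_hasCompactSupport_nonneg_nonzero hspow (fun x => by positivity)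
      (x := x₀) (by rw [hφx]; simp)
  -- A vanishing gradient would force `φ = 0` by the Sobolev inequality.
  have hA0 : 0 < A := by
    rw [hA, ← hφ.gradSq_toL2 hΩ]
    refine (gradSq_nonneg _ _).lt_of_ne fun h0 => hφ0 ?_
    have h1 := hC₁ _ (hφ.toL2_mem_H1Gamma0 hΩ hS hSm)
    have h2 := sum_enorm_weakPDeriv_le Ω hφ.toL2
    rw [← h0] at h2
    simp only [Real.sqrt_zero, mul_zero, ENNReal.ofReal_zero, nonpos_iff_eq_zero] at h2
    rw [h2, mul_zero, nonpos_iff_eq_zero] at h1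
    exact eq_zero_of_eLpNorm_eq_zero (by norm_num) h1
  -- With `t = exp s`, this is `I(tφ, 0) = 0` divided by `t²`. The left side vanishes at `s = -L/B`,
  -- and at `s₁` it is at least `A`, since there `L + s₁ B ≥ A` and the exponential is at least `1`.
  obtain ⟨s, hs⟩ : ∃ s : ℝ, Real.exp ((p - 1) * s) * (L + s * B) = A := by
    set s₁ := max 0 ((A - L) / B)
    have hs0 : -L / B ≤ s₁ := by
      refine le_trans ?_ (le_max_right _ _)
      gcongr
      linarith
    have hc : ContinuousOn (fun s : ℝ => Real.exp ((p - 1) * s) * (L + s * B))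
        (Set.Icc (-L / B) s₁) := by fun_prop
    have hmem : A ∈ Set.Icc (Real.exp ((p - 1) * (-L / B)) * (L + -L / B * B))
        (Real.exp ((p - 1) * s₁) * (L + s₁ * B)) := by
      constructor
      · rw [div_mul_cancel₀ _ hB0.ne', add_neg_cancel, mul_zero]; exact hA0.le
      · have h1 : A ≤ L + s₁ * B := by
          have := (div_le_iff₀ hB0).1 (le_max_right 0 ((A - L) / B))
          linarith
        have h2 : 1 ≤ Real.exp ((p - 1) * s₁) :=
          Real.one_le_exp (mul_nonneg (by linarith) (le_max_left _ _))
        nlinarith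
    obtain ⟨s, -, hs⟩ := intermediate_value_Icc hs0 hc hmem
    exact ⟨s, hs⟩
  set t := Real.exp s with ht
  have ht0 : 0 < t := Real.exp_pos s
  refine ⟨((hscale t).toL2, 0), ⟨(hscale t).toL2_mem_H1Gamma0 hΩ hS hSm, zero_mem_H20 hD⟩, ?_, ?_⟩
  · intro h0
    have h1 : (hscale t).toL2 = 0 := (Prod.mk.inj h0).1
    refine hφ0 ((Lp.eq_zero_iff_ae_eq_zero).2 ?_)
    filter_upwards [(Lp.eq_zero_iff_ae_eq_zero).1 h1, (hscale t).coeFn_toL2, hφ.coeFn_toL2]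
      with x e1 e2 e3
    rw [e3]
    rw [e2] at e1
    simpa [ht0.ne'] using e1
  · have hgrad : gradSq Ω (hscale t).toL2 = t ^ 2 * A := by
      rw [(hscale t).gradSq_toL2 hΩ, hA, Finset.mul_sum]
      refine Finset.sum_congr rfl fun i _ => ?_
      rw [← integral_const_mul]
      congr 1
      ext x
      have : pderiv i (fun x => t * φ x) x = t * pderiv i φ x := by
        simp only [pderiv]
        rw [fderiv_const_mul (hφ.1.differentiable (by simp) x)]
        simp
      rw [this, mul_pow]
    have hlog : logInt p Ω (hscale t).toL2 = t ^ (p + 1) * (L + s * B) := by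
      have e : logInt p Ω (hscale t).toL2 = ∫ x in Ω, (t ^ (p + 1) * (|φ x| ^ (p + 1) *
          Real.log |φ x|) + t ^ (p + 1) * s * |φ x| ^ (p + 1)) := by
        refine integral_congr_ae ?_
        filter_upwards [(hscale t).coeFn_toL2] with x hx
        rw [hx, abs_mul, abs_of_pos ht0]
        rcases (abs_nonneg (φ x)).eq_or_lt with h | h
        · rw [← h]; simp [hp0]
        · rw [Real.mul_rpow ht0.le h.le, Real.log_mul ht0.ne' h.ne', ht, Real.log_exp]
          ring
      rw [e, integral_add (hilog.const_mul _) (hipow.const_mul _), integral_const_mul,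
        integral_const_mul]
      ring
    have hpow : t ^ (p + 1) = t ^ 2 * Real.exp ((p - 1) * s) := by
      rw [ht, ← Real.exp_mul, ← Real.exp_nat_mul, ← Real.exp_add]
      congr 1
      push_cast
      ring
    simp only [I, normXSq, hgrad, hlog, laplacian_zero hD, logInt_zero, norm_zero]
    rw [hpow, mul_assoc, hs]
    ring

end StructuralAcoustic

end

/-! ### Positivity of the depth -/

theorem proposition2p2 (Ω Γ₀ Γ : Set (EuclideanSpace ℝ (Fin 3)))
    (e : EuclideanSpace ℝ (Fin 2) →ᵃⁱ[ℝ] EuclideanSpace ℝ (Fin 3))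
    (hΩ : StructuralAcoustic.IsChamber Ω Γ₀ Γ e)
    (p : ℝ) (hp1 : 1 < p) (hp5 : p < 5) :
    0 < StructuralAcoustic.depth p Ω Γ₀ (e ⁻¹' Γ) := by
  have hΓ₀ : Γ₀ ⊆ frontier Ω := by
    obtain ⟨U, -, hU⟩ := hΩ.relOpen_rigid
    exact hU ▸ Set.inter_subset_right
  have hΓ : Γ ⊆ frontier Ω := by
    obtain ⟨U, -, hU⟩ := hΩ.relOpen_elastic
    exact hU ▸ Set.inter_subset_right
  have hD : Bornology.IsBounded (e ⁻¹' Γ) :=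
    e.isometry.antilipschitz.isBounded_preimage
      ((hΩ.isBounded.closure.subset frontier_subset_closure).subset hΓ)
  obtain ⟨C₁, hC₁⟩ := hΩ.exists_sobolev_const
  obtain ⟨C₂, hC₂⟩ := StructuralAcoustic.exists_sobolev_const_H20 hD
  obtain ⟨δ, hδ, hδN⟩ :=
    StructuralAcoustic.exists_le_normXSq_of_mem_nehari hC₁ hC₂ hp5
  -- Needed because the real infimum of the empty set is `0`.
  have hne : (StructuralAcoustic.nehari p Ω Γ₀ (e ⁻¹' Γ)).Nonempty :=
    StructuralAcoustic.nehari_nonempty hΩ.isOpen hΩ.isConnected.nonempty hΩ.edge_smooth.isOpen hΓ₀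
      hΩ.measurableSet_rigid hC₁ hp1
  -- The coefficient of the squared norm in `J` once the logarithmic terms are eliminated; it is
  -- positive because `p > 1`.
  have hc : 0 < 1 / 2 - 1 / (p + 1) := by
    rw [sub_pos]
    exact one_div_lt_one_div_of_lt two_pos (by linarith)
  refine (mul_pos hc hδ).trans_le (le_csInf (hne.image _) ?_)
  rintro _ ⟨z, hz, rfl⟩
  have h1 := hδN z hz
  have h2 : StructuralAcoustic.logInt p Ω z.1 + StructuralAcoustic.logInt p (e ⁻¹' Γ) z.2 =
      StructuralAcoustic.normXSq Ω (e ⁻¹' Γ) z := by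
    have := hz.2.2
    simp only [StructuralAcoustic.I] at this
    linarith
  have h3 := StructuralAcoustic.powInt_nonneg p Ω z.1
  have h4 := StructuralAcoustic.powInt_nonneg p (e ⁻¹' Γ) z.2
  have h5 : 0 ≤ 1 / (p + 1) ^ 2 * (StructuralAcoustic.powInt p Ω z.1 +
      StructuralAcoustic.powInt p (e ⁻¹' Γ) z.2) := by positivity
  rw [StructuralAcoustic.J, h2]
  nlinarith [mul_le_mul_of_nonneg_left h1 hc.le]
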